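/- Let $k$ be an arbitrary field. For Lie algebras $A,B$ over $k$ let $A*B$ denote their free product (coproduct) in the category of Lie $k$-algebras. Let $M=ka\oplus kb$ be the two-dimensional abelian Lie algebra, $N=kx$ the one-dimensional Lie algebra, and $L=M*N$. Put $L_1=ka+kb+kx$ and $L_{i+1}=[L_1,L_i]$ for $i\ge 1$. Let $S$ be the Lie subalgebra of $L$ generated by $a,\ b,\ z=[x,a],\ t=[x,b]$. Then: 1. $L=\bigoplus_{i\ge1}L_i$ is an $\mathbb N$-graded Lie algebra ($\mathbb N=\{1,2,\dots\}$), and $S$ is a graded subalgebra of $L$ (that is, $S=\bigoplus_{i\ge 1}S\cap L_i$) which contains $M$. 2. $S$ has the presentation $\langle a,b,z,t \mid [z,b]-[t,a],\ [a,b]\rangle$ on its generators $a,b,z,t$. 3. $S$ is not isomorphic to $M*Q$ for any Lie $k$-algebra $Q$. 4. $S$ is not isomorphic to $C*D$ for any two nonzero graded Lie subalgebras $C,D$ of $S$. 5. $S$ has infinitely many ends, i.e. $\dim_k H^1(S,U(S))=\infty$, where $U(S)$ is the universal enveloping algebra of $S$, regarded as an $S$-module by multiplication. -/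

import Mathlib

noncomputable section

namespace LieKurosh

universe u v w

/-! ### Presentations and free products of Lie algebras -/

section Presentations

variable (k : Type u) [Field k]

/-- The Lie algebra `⟨X | R⟩`: the free Lie algebra on `X` modulo the ideal generated by `R`. -/
abbrev Presented {X : Type v} (R : Set (FreeLieAlgebra k X)) :=
  FreeLieAlgebra k X ⧸ LieSubmodule.lieSpan k (FreeLieAlgebra k X) R

/-- The image in `⟨X | R⟩` of the generator `x`. -/
def Presented.of {X : Type v} (R : Set (FreeLieAlgebra k X)) (x : X) : Presented k R :=
  LieSubmodule.Quotient.mk (FreeLieAlgebra.of k x)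

variable (A : Type v) [LieRing A] [LieAlgebra k A] (B : Type w) [LieRing B] [LieAlgebra k B]

variable {A} in
/-- The free generator corresponding to an element of `A`. -/
abbrev genA (x : A) : FreeLieAlgebra k (A ⊕ B) := FreeLieAlgebra.of k (Sum.inl x)

variable {B} in
/-- The free generator corresponding to an element of `B`. -/
abbrev genB (y : B) : FreeLieAlgebra k (A ⊕ B) := FreeLieAlgebra.of k (Sum.inr y)

/-- The defining relators of the free product `A * B`, on the generating set `A ⊔ B`: the
multiplication tables of `A` and of `B`. -/
inductive FreeProductRelator : FreeLieAlgebra k (A ⊕ B) → Prop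
  | inl_add (x y : A) : FreeProductRelator (genA k B (x + y) - (genA k B x + genA k B y))
  | inl_smul (c : k) (x : A) : FreeProductRelator (genA k B (c • x) - c • genA k B x)
  | inl_lie (x y : A) : FreeProductRelator (genA k B ⁅x, y⁆ - ⁅genA k B x, genA k B y⁆)
  | inr_add (x y : B) : FreeProductRelator (genB k A (x + y) - (genB k A x + genB k A y))
  | inr_smul (c : k) (x : B) : FreeProductRelator (genB k A (c • x) - c • genB k A x)
  | inr_lie (x y : B) : FreeProductRelator (genB k A ⁅x, y⁆ - ⁅genB k A x, genB k A y⁆)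

/-- The free product (coproduct) `A * B` of two Lie algebras over `k`. -/
abbrev FreeProduct := Presented k {r | FreeProductRelator k A B r}

variable {A B} in
theorem FreeProduct.mk_eq {r s : FreeLieAlgebra k (A ⊕ B)} (h : FreeProductRelator k A B (r - s)) :
    (LieSubmodule.Quotient.mk r : FreeProduct k A B) = LieSubmodule.Quotient.mk s :=
  (Submodule.Quotient.eq _).2 (LieSubmodule.subset_lieSpan h)

/-- The canonical homomorphism `A → A * B`. -/
def FreeProduct.inl : A →ₗ⁅k⁆ FreeProduct k A B where
  toFun x := Presented.of k _ (.inl x)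
  map_add' x y := FreeProduct.mk_eq k (.inl_add x y)
  map_smul' c x := FreeProduct.mk_eq k (.inl_smul c x)
  map_lie' {x y} := FreeProduct.mk_eq k (.inl_lie x y)

/-- The canonical homomorphism `B → A * B`. -/
def FreeProduct.inr : B →ₗ⁅k⁆ FreeProduct k A B where
  toFun x := Presented.of k _ (.inr x)
  map_add' x y := FreeProduct.mk_eq k (.inr_add x y)
  map_smul' c x := FreeProduct.mk_eq k (.inr_smul c x)
  map_lie' {x y} := FreeProduct.mk_eq k (.inr_lie x y)

end Presentations

/-! ### Abelian Lie algebras -/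

/-- The vector space `V` regarded as an abelian Lie algebra. -/
def AbelianLie (V : Type v) : Type v := V

instance (V : Type v) [AddCommGroup V] : AddCommGroup (AbelianLie V) :=
  inferInstanceAs (AddCommGroup V)

instance (k : Type u) [Field k] (V : Type v) [AddCommGroup V] [Module k V] :
    Module k (AbelianLie V) := inferInstanceAs (Module k V)

instance (V : Type v) [AddCommGroup V] : LieRing (AbelianLie V) where
  bracket _ _ := 0
  add_lie _ _ _ := (add_zero 0).symm
  lie_add _ _ _ := (add_zero 0).symm
  lie_self _ := rfl
  leibniz_lie _ _ _ := (add_zero 0).symm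

instance (k : Type u) [Field k] (V : Type v) [AddCommGroup V] [Module k V] :
    LieAlgebra k (AbelianLie V) where
  lie_smul c _ _ := (smul_zero c).symm

/-- The identity map from `V` to the abelian Lie algebra on `V`. -/
def AbelianLie.of (k : Type u) [Field k] (V : Type v) [AddCommGroup V] [Module k V] :
    V ≃ₗ[k] AbelianLie V := LinearEquiv.refl k V

/-! ### Gradings by the positive integers -/

section Gradings

variable {k : Type u} [Field k] {L : Type v} [LieRing L] [LieAlgebra k L]

/-- `L = ⨁_{i ≥ 1} G i` as a vector space, and `[G i, G j] ⊆ G (i + j)`.  The grading is indexed by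
`{0, 1, 2, …}` with zero component in degree `0`. -/
structure IsPositiveGrading (G : ℕ → Submodule k L) : Prop where
  zero : G 0 = ⊥
  isInternal : DirectSum.IsInternal G
  lie_mem : ∀ i j : ℕ, ∀ x ∈ G i, ∀ y ∈ G j, ⁅x, y⁆ ∈ G (i + j)

/-- A graded (homogeneous) Lie subalgebra: it is the sum of its intersections with the graded
components. -/
def IsGradedSubalgebra (G : ℕ → Submodule k L) (C : LieSubalgebra k L) : Prop :=
  C.toSubmodule = ⨆ i, C.toSubmodule ⊓ G i

end Gradings

/-! ### First cohomology and ends -/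

section Cohomology

variable (k : Type u) [Field k] (L : Type v) [LieRing L] [LieAlgebra k L]

section Coefficients

variable (V : Type w) [AddCommGroup V] [Module k V] [LieRingModule L V] [LieModule k L V]

/-- The Chevalley–Eilenberg differential from `0`-cochains to `1`-cochains, `v ↦ (x ↦ [x, v])`. -/
def d₀₁ : V →ₗ[k] LieModule.Cohomology.oneCochain k L V where
  toFun v :=
    { toFun := fun x => ⁅x, v⁆
      map_add' := fun x y => add_lie x y v
      map_smul' := fun c x => smul_lie c x v }
  map_add' v w := by ext x; exact lie_add x v w
  map_smul' c v := by ext x; exact lie_smul c x v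

/-- `H¹(L, V)`: the `1`-cocycles modulo the `1`-coboundaries of the Chevalley–Eilenberg complex. -/
abbrev H1 :=
  LinearMap.ker (LieModule.Cohomology.d₁₂ k L V) ⧸
    (LinearMap.range (d₀₁ k L V)).submoduleOf (LinearMap.ker (LieModule.Cohomology.d₁₂ k L V))

end Coefficients

/-- The universal enveloping algebra `U(L)`, as an `L`-module under left multiplication. -/
def RegularModule := UniversalEnvelopingAlgebra k L

instance : AddCommGroup (RegularModule k L) :=
  inferInstanceAs (AddCommGroup (UniversalEnvelopingAlgebra k L))

instance : Module k (RegularModule k L) :=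
  inferInstanceAs (Module k (UniversalEnvelopingAlgebra k L))

/-- The identity map from `U(L)` to the regular module. -/
def RegularModule.equiv : UniversalEnvelopingAlgebra k L ≃ₗ[k] RegularModule k L :=
  LinearEquiv.refl k (UniversalEnvelopingAlgebra k L)

attribute [local instance 100] LieRing.ofAssociativeRing in
theorem RegularModule.ι_lie (x y : L) :
    UniversalEnvelopingAlgebra.ι k ⁅x, y⁆ =
      UniversalEnvelopingAlgebra.ι k x * UniversalEnvelopingAlgebra.ι k y -
        UniversalEnvelopingAlgebra.ι k y * UniversalEnvelopingAlgebra.ι k x := by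
  rw [LieHom.map_lie, LieRing.of_associative_ring_bracket]

instance : LieRingModule L (RegularModule k L) where
  bracket x u := RegularModule.equiv k L
    (UniversalEnvelopingAlgebra.ι k x * (RegularModule.equiv k L).symm u)
  add_lie x y u := by simp only [map_add, add_mul]
  lie_add x u v := by simp only [map_add, mul_add]
  leibniz_lie x y u := by
    simp only [LinearEquiv.symm_apply_apply, RegularModule.ι_lie, sub_mul, mul_assoc, ← map_add,
      sub_add_cancel]

instance : LieModule k L (RegularModule k L) where
  smul_lie c x u := by
    change RegularModule.equiv k L (_ * _) = c • RegularModule.equiv k L (_ * _)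
    rw [map_smul, smul_mul_assoc, map_smul]
  lie_smul c x u := by
    change RegularModule.equiv k L (_ * _) = c • RegularModule.equiv k L (_ * _)
    rw [map_smul, mul_smul_comm, map_smul]

/-- `L` has infinitely many ends: `dim_k H¹(L, U(L)) = ∞`. -/
def HasInfinitelyManyEnds : Prop := ¬ FiniteDimensional k (H1 k L (RegularModule k L))

end Cohomology

/-! ### The example -/

section Example

variable (k : Type u) [Field k]

/-- The two-dimensional abelian Lie algebra `M = ka ⊕ kb`. -/
abbrev M := AbelianLie (k × k)

/-- The one-dimensional Lie algebra `N = kx`. -/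
abbrev N := AbelianLie k

/-- `L = M * N`. -/
abbrev L := FreeProduct k (M k) (N k)

/-- The element `a` of `L`. -/
def a : L k := FreeProduct.inl k (M k) (N k) (AbelianLie.of k (k × k) (1, 0))

/-- The element `b` of `L`. -/
def b : L k := FreeProduct.inl k (M k) (N k) (AbelianLie.of k (k × k) (0, 1))

/-- The element `x` of `L`. -/
def x : L k := FreeProduct.inr k (M k) (N k) (AbelianLie.of k k 1)

/-- The grading of `L` with `a, b, x` in degree one: `L₁ = ka + kb + kx` and `Lᵢ₊₁ = [L₁, Lᵢ]`. -/
def grading : ℕ → Submodule k (L k)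
  | 0 => ⊥
  | 1 => Submodule.span k {a k, b k, x k}
  | i + 2 => Submodule.span k
      {w | ∃ y ∈ Submodule.span k {a k, b k, x k}, ∃ v ∈ grading (i + 1), w = ⁅y, v⁆}

/-- The Lie subalgebra `S` of `L` generated by `a`, `b`, `z = [x, a]` and `t = [x, b]`. -/
def S : LieSubalgebra k (L k) :=
  LieSubalgebra.lieSpan k (L k) {a k, b k, ⁅x k, a k⁆, ⁅x k, b k⁆}

/-- The four generators of the presentation of `S`. -/
inductive Gen
  | a | b | z | t

/-- The relators `[z, b] - [t, a]` and `[a, b]`. -/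
def relators : Set (FreeLieAlgebra k Gen) :=
  {⁅FreeLieAlgebra.of k Gen.z, FreeLieAlgebra.of k Gen.b⁆ -
      ⁅FreeLieAlgebra.of k Gen.t, FreeLieAlgebra.of k Gen.a⁆,
    ⁅FreeLieAlgebra.of k Gen.a, FreeLieAlgebra.of k Gen.b⁆}

/-- The elements `a`, `b`, `z = [x, a]`, `t = [x, b]` of `L`. -/
def genInL : Gen → L k
  | .a => a k
  | .b => b k
  | .z => ⁅x k, a k⁆
  | .t => ⁅x k, b k⁆

end Example

end LieKurosh

end

noncomputable section

namespace LieKurosh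

/-! ### Universal properties of presentations and free products. -/

section Lifts

variable {k : Type*} [Field k] {X : Type*} {G : Type*} [LieRing G] [LieAlgebra k G]

/-! The kernel of the map `L → M` killing `x` is free on the monomials of `k[a, b]`: the monomial
`1` is `x`, and `ad a`, `ad b` act on monomials as multiplication by the two variables. Inside this
semidirect product, `S` is the part built on the nonconstant monomials. They span the ideal `(a, b)`
of `k[a, b]`, which has two generators, accounting for `z` and `t`, and one syzygy, which is the
relator `[z, b] - [t, a]`.

For the presentation only injectivity is needed. The presented algebra has a one-sided inverse to
its map into the model on nonconstant monomials (`Pres.ofModel_comp_toModel`), that model embeds in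
the one on all monomials (`Model.map_injective`), and the resulting square with `L` commutes, so the
presented algebra embeds in `L` with image `S` (`Pres.toL_injective`, `Pres.range_toL`).

If `S = C * D`, characters of `C` and `D` combine to a homomorphism into the Heisenberg algebra,
where each quadratic relation of `S` becomes a determinant identity (`values_relation`). Linear
algebra on the four-dimensional space of characters then makes one factor perfect
(`perfect_or_perfect`). But a nonzero graded subalgebra is not perfect, as brackets miss its lowest
degree. Neither is `M`, nor a complement `Q` of `M`, because the abelianization of `S` is too large
to come from `M` alone.

For the ends, every `v` in a module gives a derivation `a, b ↦ 0`, `z ↦ [a, v]`, `t ↦ [b, v]`,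
compatible with the relators because `a` and `b` commute. If `a` acts injectively, this derivation
is inner only for `v = 0`, so the module embeds in `H¹` (`not_finiteDimensional_H1`). On `U(S)` left
multiplication by `a` is injective because `U(S)` is the differential operator extension `U(K)[a;
δ]`, where `K` is the kernel of a character taking the value `1` at `a`. -/

theorem FreeLieAlgebra.lieSpan_range_of :
    LieSubalgebra.lieSpan k (FreeLieAlgebra k X) (Set.range (FreeLieAlgebra.of k)) = ⊤ := by
  set T := LieSubalgebra.lieSpan k (FreeLieAlgebra k X) (Set.range (FreeLieAlgebra.of k))
  let f : FreeLieAlgebra k X →ₗ⁅k⁆ T :=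
    FreeLieAlgebra.lift k fun x => ⟨FreeLieAlgebra.of k x, LieSubalgebra.subset_lieSpan ⟨x, rfl⟩⟩
  -- Lifting the generators into `T` and including back fixes them, so every element is its own
  -- image and lies in `T`.
  have h : T.incl.comp f = LieHom.id := by
    ext x
    simp [f]
  refine eq_top_iff.2 fun y _ => ?_
  have := LieHom.congr_fun h y
  simp only [LieHom.comp_apply, LieHom.id_apply] at this
  rw [← this]
  exact (f y).2

/-- The universal property of a presentation. -/
def Presented.lift {R : Set (FreeLieAlgebra k X)} (f : X → G)
    (h : ∀ r ∈ R, FreeLieAlgebra.lift k f r = 0) : Presented k R →ₗ⁅k⁆ G where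
  toLinearMap := Submodule.liftQ (LieSubmodule.lieSpan k (FreeLieAlgebra k X) R).toSubmodule
    (FreeLieAlgebra.lift k f : FreeLieAlgebra k X →ₗ[k] G) (by
      change LieSubmodule.lieSpan k (FreeLieAlgebra k X) R ≤ (FreeLieAlgebra.lift k f).ker
      rw [LieSubmodule.lieSpan_le]
      exact fun r hr => (LieHom.mem_ker).2 (h r hr))
  map_lie' {p q} := by
    obtain ⟨p, rfl⟩ := LieSubmodule.Quotient.surjective_mk' _ p
    obtain ⟨q, rfl⟩ := LieSubmodule.Quotient.surjective_mk' _ q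
    exact LieHom.map_lie (FreeLieAlgebra.lift k f) p q

theorem Presented.lift_mk {R : Set (FreeLieAlgebra k X)} (f : X → G)
    (h : ∀ r ∈ R, FreeLieAlgebra.lift k f r = 0) (y : FreeLieAlgebra k X) :
    Presented.lift f h (LieSubmodule.Quotient.mk y) = FreeLieAlgebra.lift k f y := rfl

@[simp]
theorem Presented.lift_of {R : Set (FreeLieAlgebra k X)} (f : X → G)
    (h : ∀ r ∈ R, FreeLieAlgebra.lift k f r = 0) (x : X) :
    Presented.lift f h (Presented.of k R x) = f x :=
  (Presented.lift_mk f h _).trans (FreeLieAlgebra.lift_of_apply f x)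

/-- The projection from the free Lie algebra. -/
def Presented.proj (R : Set (FreeLieAlgebra k X)) : FreeLieAlgebra k X →ₗ⁅k⁆ Presented k R where
  toLinearMap := (LieSubmodule.Quotient.mk' (LieSubmodule.lieSpan k (FreeLieAlgebra k X) R) :
    FreeLieAlgebra k X →ₗ[k] _)
  map_lie' := rfl

theorem Presented.proj_surjective (R : Set (FreeLieAlgebra k X)) :
    Function.Surjective (Presented.proj R) := LieSubmodule.Quotient.surjective_mk' _

theorem Presented.proj_eq_zero {R : Set (FreeLieAlgebra k X)} {r : FreeLieAlgebra k X}
    (h : r ∈ R) : Presented.proj R r = 0 :=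
  (LieSubmodule.Quotient.mk_eq_zero _).2 (LieSubmodule.subset_lieSpan h)

theorem Presented.hom_ext {R : Set (FreeLieAlgebra k X)} {f g : Presented k R →ₗ⁅k⁆ G}
    (h : ∀ x, f (Presented.of k R x) = g (Presented.of k R x)) : f = g := by
  have : f.comp (Presented.proj R) = g.comp (Presented.proj R) :=
    FreeLieAlgebra.hom_ext fun x => h x
  ext y
  obtain ⟨y, rfl⟩ := Presented.proj_surjective R y
  exact LieHom.congr_fun this y

theorem Presented.lieSpan_range_of (R : Set (FreeLieAlgebra k X)) :
    LieSubalgebra.lieSpan k (Presented k R) (Set.range (Presented.of k R)) = ⊤ := by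
  refine eq_top_iff.2 fun y _ => ?_
  obtain ⟨y, rfl⟩ := Presented.proj_surjective R y
  have hy : y ∈ LieSubalgebra.lieSpan k (FreeLieAlgebra k X)
      (Set.range (FreeLieAlgebra.of k)) := by
    rw [FreeLieAlgebra.lieSpan_range_of]; trivial
  have : LieSubalgebra.lieSpan k (FreeLieAlgebra k X) (Set.range (FreeLieAlgebra.of k)) ≤
      (LieSubalgebra.lieSpan k (Presented k R) (Set.range (Presented.of k R))).comap
        (Presented.proj R) := by
    rw [LieSubalgebra.lieSpan_le]
    rintro _ ⟨x, rfl⟩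
    exact LieSubalgebra.subset_lieSpan ⟨x, rfl⟩
  exact this hy

variable {A B : Type*} [LieRing A] [LieAlgebra k A] [LieRing B] [LieAlgebra k B]

/-- The universal property of the free product. -/
def FreeProduct.lift (f : A →ₗ⁅k⁆ G) (g : B →ₗ⁅k⁆ G) : FreeProduct k A B →ₗ⁅k⁆ G :=
  Presented.lift (Sum.elim f g) (by
    rintro r hr
    cases hr <;> simp [genA, genB])

@[simp]
theorem FreeProduct.lift_inl (f : A →ₗ⁅k⁆ G) (g : B →ₗ⁅k⁆ G) (x : A) :
    FreeProduct.lift f g (FreeProduct.inl k A B x) = f x :=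
  Presented.lift_of _ _ _

@[simp]
theorem FreeProduct.lift_inr (f : A →ₗ⁅k⁆ G) (g : B →ₗ⁅k⁆ G) (x : B) :
    FreeProduct.lift f g (FreeProduct.inr k A B x) = g x :=
  Presented.lift_of _ _ _

theorem FreeProduct.hom_ext {f g : FreeProduct k A B →ₗ⁅k⁆ G}
    (h₁ : ∀ x, f (FreeProduct.inl k A B x) = g (FreeProduct.inl k A B x))
    (h₂ : ∀ x, f (FreeProduct.inr k A B x) = g (FreeProduct.inr k A B x)) : f = g :=
  Presented.hom_ext (by rintro (x | x); exacts [h₁ x, h₂ x])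

end Lifts

/-! ### Derivations as splittings of split extensions. -/

section SquareZero

variable (k : Type*) [Field k] (G : Type*) [LieRing G] [LieAlgebra k G]
  (V : Type*) [AddCommGroup V] [Module k V] [LieRingModule G V] [LieModule k G V]

/-- The split extension of `G` by the module `V`. -/
def SquareZero (G V : Type*) := G × V

instance : AddCommGroup (SquareZero G V) := inferInstanceAs (AddCommGroup (G × V))

instance : Module k (SquareZero G V) := inferInstanceAs (Module k (G × V))

instance : LieRing (SquareZero G V) where
  bracket p q := (⁅p.1, q.1⁆, ⁅p.1, q.2⁆ - ⁅q.1, p.2⁆)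
  add_lie p q r := Prod.ext (add_lie p.1 q.1 r.1) <| by
    change ⁅p.1 + q.1, r.2⁆ - ⁅r.1, p.2 + q.2⁆ = ⁅p.1, r.2⁆ - ⁅r.1, p.2⁆ + (⁅q.1, r.2⁆ - ⁅r.1, q.2⁆)
    rw [add_lie, lie_add]; abel
  lie_add p q r := Prod.ext (lie_add p.1 q.1 r.1) <| by
    change ⁅p.1, q.2 + r.2⁆ - ⁅q.1 + r.1, p.2⁆ = ⁅p.1, q.2⁆ - ⁅q.1, p.2⁆ + (⁅p.1, r.2⁆ - ⁅r.1, p.2⁆)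
    rw [add_lie, lie_add]; abel
  lie_self p := Prod.ext (lie_self p.1) (sub_self _)
  leibniz_lie p q r := Prod.ext (leibniz_lie p.1 q.1 r.1) <| by
    change ⁅p.1, ⁅q.1, r.2⁆ - ⁅r.1, q.2⁆⁆ - ⁅⁅q.1, r.1⁆, p.2⁆ =
      ⁅⁅p.1, q.1⁆, r.2⁆ - ⁅r.1, ⁅p.1, q.2⁆ - ⁅q.1, p.2⁆⁆ +
        (⁅q.1, ⁅p.1, r.2⁆ - ⁅r.1, p.2⁆⁆ - ⁅⁅p.1, r.1⁆, q.2⁆)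
    simp only [lie_sub, lie_lie]; abel

instance : LieAlgebra k (SquareZero G V) where
  lie_smul c p q := Prod.ext (lie_smul c p.1 q.1) <| by
    change ⁅p.1, c • q.2⁆ - ⁅c • q.1, p.2⁆ = c • (⁅p.1, q.2⁆ - ⁅q.1, p.2⁆)
    rw [lie_smul, smul_lie, smul_sub]

/-- The element of the split extension with given components. -/
def SquareZero.mk {G V : Type*} (x : G) (v : V) : SquareZero G V := (x, v)

/-- The projection of the split extension onto `G`. -/
def SquareZero.fst : SquareZero G V →ₗ⁅k⁆ G where
  toLinearMap := LinearMap.fst k G V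
  map_lie' := rfl

variable {k G V}

/-- A splitting of the split extension is a derivation. -/
def SquareZero.derivation (f : G →ₗ⁅k⁆ SquareZero G V) (h : (SquareZero.fst k G V).comp f = 1) :
    LieDerivation k G V where
  toLinearMap := LinearMap.snd k G V ∘ₗ (f : G →ₗ[k] SquareZero G V)
  leibniz' p q := by
    have h1 : ∀ p, (f p).1 = p := fun p => LieHom.congr_fun h p
    change (f ⁅p, q⁆).2 = ⁅p, (f q).2⁆ - ⁅q, (f p).2⁆
    rw [LieHom.map_lie]
    change ⁅(f p).1, (f q).2⁆ - ⁅(f q).1, (f p).2⁆ = _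
    rw [h1, h1]

theorem SquareZero.derivation_apply (f : G →ₗ⁅k⁆ SquareZero G V)
    (h : (SquareZero.fst k G V).comp f = 1) (p : G) : SquareZero.derivation f h p = (f p).2 := rfl

end SquareZero

/-! ### Derivations of free Lie algebras. -/

section FreeDerivation

variable {k : Type*} [Field k] {X : Type*}

/-- The derivation of a free Lie algebra with given values on the generators. -/
def freeDerivation (f : X → FreeLieAlgebra k X) :
    LieDerivation k (FreeLieAlgebra k X) (FreeLieAlgebra k X) :=
  SquareZero.derivation
    (FreeLieAlgebra.lift k fun x =>
      SquareZero.mk (FreeLieAlgebra.of k x) (f x))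
    (FreeLieAlgebra.hom_ext fun x => by
      rw [LieHom.comp_apply, FreeLieAlgebra.lift_of_apply]; rfl)

@[simp]
theorem freeDerivation_of (f : X → FreeLieAlgebra k X) (x : X) :
    freeDerivation f (FreeLieAlgebra.of k x) = f x := by
  rw [freeDerivation, SquareZero.derivation_apply, FreeLieAlgebra.lift_of_apply]; rfl

end FreeDerivation

/-! ### Semidirect products of a free Lie algebra by `M`. -/

section SemidirectModel

open LieAlgebra

variable (k : Type*) [Field k] {X : Type*} {α β : X → X} (hαβ : ∀ x, α (β x) = β (α x))

/-- The derivation of the free Lie algebra induced by a self-map of the generators. -/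
def mapDerivation (α : X → X) : LieDerivation k (FreeLieAlgebra k X) (FreeLieAlgebra k X) :=
  freeDerivation fun x => FreeLieAlgebra.of k (α x)

@[simp]
theorem mapDerivation_of (α : X → X) (x : X) :
    mapDerivation k α (FreeLieAlgebra.of k x) = FreeLieAlgebra.of k (α x) :=
  freeDerivation_of _ x

variable {k} in
theorem freeDerivation_ext {D₁ D₂ : LieDerivation k (FreeLieAlgebra k X) (FreeLieAlgebra k X)}
    (h : ∀ x, D₁ (FreeLieAlgebra.of k x) = D₂ (FreeLieAlgebra.of k x)) : D₁ = D₂ :=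
  LieDerivation.ext_of_lieSpan_eq_top _ FreeLieAlgebra.lieSpan_range_of
    (by rintro _ ⟨x, rfl⟩; exact h x)

include hαβ in
theorem mapDerivation_comm : ⁅mapDerivation k α, mapDerivation k β⁆ = 0 :=
  freeDerivation_ext fun x => by simp [hαβ]

/-- Two commuting self-maps of `X` make the abelian Lie algebra `M` act on the free Lie algebra on
`X`. -/
def actionOfMaps : M k →ₗ⁅k⁆ LieDerivation k (FreeLieAlgebra k X) (FreeLieAlgebra k X) where
  toFun m := ((AbelianLie.of k (k × k)).symm m).1 • mapDerivation k α +
    ((AbelianLie.of k (k × k)).symm m).2 • mapDerivation k β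
  map_add' m n := by simp only [map_add, Prod.fst_add, Prod.snd_add, add_smul]; abel
  map_smul' c m := by simp [mul_smul]
  map_lie' {m n} := by
    have h : ⁅mapDerivation k β, mapDerivation k α⁆ = 0 := by
      rw [← lie_skew, mapDerivation_comm k hαβ, neg_zero]
    have h0 : ⁅m, n⁆ = 0 := rfl
    simp [h0, mapDerivation_comm k hαβ, h]

/-- The semidirect product of the free Lie algebra on `X` by `M`. -/
abbrev Model := SemiDirectSum (FreeLieAlgebra k X) (M k) (actionOfMaps k hαβ)

namespace Model

/-- The element `a` of the semidirect product. -/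
def a : Model k hαβ := ⟨0, AbelianLie.of k (k × k) (1, 0)⟩

/-- The element `b` of the semidirect product. -/
def b : Model k hαβ := ⟨0, AbelianLie.of k (k × k) (0, 1)⟩

/-- The free generators of the semidirect product. -/
def gen (x : X) : Model k hαβ := ⟨FreeLieAlgebra.of k x, 0⟩

theorem lie_mk (u v : FreeLieAlgebra k X) (m n : M k) :
    ⁅(⟨u, m⟩ : Model k hαβ), (⟨v, n⟩ : Model k hαβ)⁆ =
      ⟨⁅u, v⁆ + (((AbelianLie.of k (k × k)).symm m).1 • mapDerivation k α v +
        ((AbelianLie.of k (k × k)).symm m).2 • mapDerivation k β v) -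
        (((AbelianLie.of k (k × k)).symm n).1 • mapDerivation k α u +
        ((AbelianLie.of k (k × k)).symm n).2 • mapDerivation k β u), 0⟩ := rfl

theorem a_lie_b : ⁅a k hαβ, b k hαβ⁆ = 0 := by
  rw [a, b, lie_mk]
  simp

theorem a_lie_gen (x : X) : ⁅a k hαβ, gen k hαβ x⁆ = gen k hαβ (α x) := by
  rw [a, gen, lie_mk]
  simp [gen]

theorem b_lie_gen (x : X) : ⁅b k hαβ, gen k hαβ x⁆ = gen k hαβ (β x) := by
  rw [b, gen, lie_mk]
  simp [gen]

variable {k hαβ} {G : Type*} [LieRing G] [LieAlgebra k G]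

/-- The universal property of the semidirect product. -/
def lift (p q : G) (f : X → G) (hpq : ⁅p, q⁆ = 0) (hp : ∀ x, ⁅p, f x⁆ = f (α x))
    (hq : ∀ x, ⁅q, f x⁆ = f (β x)) : Model k hαβ →ₗ⁅k⁆ G :=
  -- Both sides are derivations along the lift of `f`, so agreement on the free generators is
  -- enough.
  have key : ∀ (γ : X → X) (r : G), (∀ x, ⁅r, f x⁆ = f (γ x)) → ∀ u,
      FreeLieAlgebra.lift k f (mapDerivation k γ u) = ⁅r, FreeLieAlgebra.lift k f u⁆ := by
    intro γ r hr u
    have hu : u ∈ LieSubalgebra.lieSpan k (FreeLieAlgebra k X)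
        (Set.range (FreeLieAlgebra.of k)) := by
      rw [FreeLieAlgebra.lieSpan_range_of]; trivial
    induction hu using LieSubalgebra.lieSpan_induction with
    | mem x hx => obtain ⟨x, rfl⟩ := hx; simp [hr]
    | zero => simp
    | add x y _ _ hx hy => simp [hx, hy]
    | smul t x _ hx => simp [hx]
    | lie x y _ _ hx hy =>
      rw [LieDerivation.apply_lie_eq_add, map_add, LieHom.map_lie, LieHom.map_lie, LieHom.map_lie,
        hx, hy, leibniz_lie r, add_comm]
  { toFun := fun w => FreeLieAlgebra.lift k f w.left +
      (((AbelianLie.of k (k × k)).symm w.right).1 • p +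
        ((AbelianLie.of k (k × k)).symm w.right).2 • q)
    map_add' := fun v w => by
      simp only [SemiDirectSum.add_eq_mk, map_add, Prod.fst_add, Prod.snd_add, add_smul]; abel
    map_smul' := fun c v => by simp [mul_smul]
    map_lie' := fun {v w} => by
      obtain ⟨u, m⟩ := v
      obtain ⟨u', n⟩ := w
      have hqp : ⁅q, p⁆ = 0 := by rw [← lie_skew, hpq, neg_zero]
      rw [lie_mk]
      simp only [map_zero, Prod.fst_zero, Prod.snd_zero, zero_smul,
        add_zero, map_add, map_sub, LieHom.map_lie, map_smul, key α p hp, key β q hq,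
        lie_add, add_lie, lie_smul, smul_lie, hpq, hqp, lie_self, smul_zero,
        ← lie_skew p ((FreeLieAlgebra.lift k f) u), ← lie_skew q ((FreeLieAlgebra.lift k f) u)]
      module }

variable (p q : G) (f : X → G) (hpq : ⁅p, q⁆ = 0) (hp : ∀ x, ⁅p, f x⁆ = f (α x))
    (hq : ∀ x, ⁅q, f x⁆ = f (β x))

theorem lift_apply (w : Model k hαβ) : lift p q f hpq hp hq w = FreeLieAlgebra.lift k f w.left +
      (((AbelianLie.of k (k × k)).symm w.right).1 • p +
        ((AbelianLie.of k (k × k)).symm w.right).2 • q) := rfl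

@[simp]
theorem lift_a : lift p q f hpq hp hq (a k hαβ) = p := by simp [lift_apply, a]

@[simp]
theorem lift_b : lift p q f hpq hp hq (b k hαβ) = q := by simp [lift_apply, b]

@[simp]
theorem lift_gen (x : X) : lift p q f hpq hp hq (gen k hαβ x) = f x := by simp [lift_apply, gen]

variable {Y : Type*} {α' β' : Y → Y} (hαβ' : ∀ y, α' (β' y) = β' (α' y))

/-- The homomorphism of semidirect products induced by an equivariant map of the generators. -/
def map (j : Y → X) (h1 : ∀ y, j (α' y) = α (j y)) (h2 : ∀ y, j (β' y) = β (j y)) :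
    Model k hαβ' →ₗ⁅k⁆ Model k hαβ :=
  lift (a k hαβ) (b k hαβ) (fun y => gen k hαβ (j y)) (a_lie_b k hαβ)
    (fun y => by rw [a_lie_gen, h1]) (fun y => by rw [b_lie_gen, h2])

variable {hαβ'} (j : Y → X) (h1 : ∀ y, j (α' y) = α (j y)) (h2 : ∀ y, j (β' y) = β (j y))

@[simp]
theorem map_a : map hαβ' j h1 h2 (a k hαβ') = a k hαβ := lift_a _ _ _ _ _ _

@[simp]
theorem map_b : map hαβ' j h1 h2 (b k hαβ') = b k hαβ := lift_b _ _ _ _ _ _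

@[simp]
theorem map_gen (y : Y) : map hαβ' j h1 h2 (gen k hαβ' y) = gen k hαβ (j y) :=
  lift_gen _ _ _ _ _ _ _

/-- The free part has a retraction `r`, which sends the generators outside the image of `j` to zero,
while the `M`-component is carried along unchanged. -/
theorem map_injective (hj : Function.Injective j) :
    Function.Injective (map (k := k) (hαβ := hαβ) hαβ' j h1 h2) := by
  classical
  let r : FreeLieAlgebra k X →ₗ⁅k⁆ FreeLieAlgebra k Y := FreeLieAlgebra.lift k fun x =>
    if h : ∃ y, j y = x then FreeLieAlgebra.of k h.choose else 0
  have hr : ∀ y, r (FreeLieAlgebra.of k (j y)) = FreeLieAlgebra.of k y := fun y => by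
    have h : ∃ y', j y' = j y := ⟨y, rfl⟩
    have h' : h.choose = y := hj h.choose_spec
    simp only [r, FreeLieAlgebra.lift_of_apply]
    rw [dif_pos h, h']
  have hl : ∀ u, FreeLieAlgebra.lift k (fun y => gen k hαβ (j y)) u =
      SemiDirectSum.inl _ (FreeLieAlgebra.lift k (fun y => FreeLieAlgebra.of k (j y)) u) := by
    intro u
    have : FreeLieAlgebra.lift k (fun y => gen k hαβ (j y)) =
      (SemiDirectSum.inl _).comp (FreeLieAlgebra.lift k (fun y => FreeLieAlgebra.of k (j y))) :=
      FreeLieAlgebra.hom_ext fun y => by simp [gen]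
    rw [this]; rfl
  have hrl : ∀ u, r (FreeLieAlgebra.lift k (fun y => FreeLieAlgebra.of k (j y)) u) = u := by
    intro u
    have : r.comp (FreeLieAlgebra.lift k (fun y => FreeLieAlgebra.of k (j y))) = LieHom.id :=
      FreeLieAlgebra.hom_ext fun y => by simp [hr]
    exact LieHom.congr_fun this u
  rw [injective_iff_map_eq_zero]
  rintro ⟨u, m⟩ h
  rw [map, lift_apply, hl] at h
  simp only [SemiDirectSum.inl_eq_mk, a, b, SemiDirectSum.smul_eq_mk, smul_zero,
    SemiDirectSum.add_eq_mk, add_zero, zero_add, SemiDirectSum.zero_eq_mk,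
    SemiDirectSum.mk.injEq] at h ⊢
  refine ⟨?_, ?_⟩
  · rw [← hrl u, h.1, map_zero]
  · rw [← map_smul, ← map_smul, ← map_add, LinearEquiv.map_eq_zero_iff] at h
    apply (AbelianLie.of k (k × k)).symm.map_eq_zero_iff.1
    simpa using h.2

end Model

end SemidirectModel

/-! ### Homomorphisms out of `L` and out of the presented algebra. -/

section Relations

variable (k : Type*) [Field k]

theorem a_lie_b : ⁅a k, b k⁆ = 0 := by
  rw [a, b, ← LieHom.map_lie]
  exact map_zero _

/-- The Lie algebra presented by `relators`. -/
abbrev Pres := Presented k (relators k)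

/-- The generators of the presented Lie algebra. -/
abbrev Pres.of (g : Gen) : Pres k := Presented.of k (relators k) g

theorem Pres.a_lie_b : ⁅Pres.of k .a, Pres.of k .b⁆ = 0 := by
  have := Presented.proj_eq_zero (R := relators k) (Or.inr rfl)
  rwa [LieHom.map_lie] at this

theorem Pres.z_lie_b : ⁅Pres.of k .z, Pres.of k .b⁆ = ⁅Pres.of k .t, Pres.of k .a⁆ := by
  have := Presented.proj_eq_zero (R := relators k) (Or.inl rfl)
  rw [map_sub, LieHom.map_lie, LieHom.map_lie] at this
  exact sub_eq_zero.1 this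

variable {k} {G : Type*} [LieRing G] [LieAlgebra k G]

/-- The universal property of the presented Lie algebra. -/
def Pres.lift (f : Gen → G) (h1 : ⁅f .z, f .b⁆ = ⁅f .t, f .a⁆) (h2 : ⁅f .a, f .b⁆ = 0) :
    Pres k →ₗ⁅k⁆ G :=
  Presented.lift f (by rintro r (rfl | rfl) <;> simp [h1, h2])

@[simp]
theorem Pres.lift_of (f : Gen → G) (h1 : ⁅f .z, f .b⁆ = ⁅f .t, f .a⁆) (h2 : ⁅f .a, f .b⁆ = 0)
    (g : Gen) : Pres.lift (k := k) f h1 h2 (Pres.of k g) = f g :=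
  Presented.lift_of _ _ _

/-- A Lie homomorphism out of `L` given by two commuting elements and a third one. -/
def L.lift (p q r : G) (h : ⁅p, q⁆ = 0) : L k →ₗ⁅k⁆ G :=
  FreeProduct.lift
    { toFun := fun m => ((AbelianLie.of k (k × k)).symm m).1 • p +
        ((AbelianLie.of k (k × k)).symm m).2 • q
      map_add' := fun m n => by simp only [map_add, Prod.fst_add, Prod.snd_add, add_smul]; abel
      map_smul' := fun c m => by simp [mul_smul]
      map_lie' := fun {m n} => by
        have h0 : ⁅m, n⁆ = 0 := rfl
        have h' : ⁅q, p⁆ = 0 := by rw [← lie_skew, h, neg_zero]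
        simp [h0, h, h'] }
    { toFun := fun m => (AbelianLie.of k k).symm m • r
      map_add' := fun m n => by simp only [map_add, add_smul]
      map_smul' := fun c m => by simp [mul_smul]
      map_lie' := fun {m n} => by
        have h0 : ⁅m, n⁆ = 0 := rfl
        simp [h0] }

variable (p q r : G) (h : ⁅p, q⁆ = 0)

@[simp]
theorem L.lift_a : L.lift p q r h (a k) = p := by
  rw [L.lift, a, FreeProduct.lift_inl]
  simp

@[simp]
theorem L.lift_b : L.lift p q r h (b k) = q := by
  rw [L.lift, b, FreeProduct.lift_inl]
  simp

@[simp]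
theorem L.lift_x : L.lift p q r h (x k) = r := by
  rw [L.lift, x, FreeProduct.lift_inr]
  simp

theorem M.eq_smul_add_smul (m : M k) :
    m = ((AbelianLie.of k (k × k)).symm m).1 • AbelianLie.of k (k × k) (1, 0) +
      ((AbelianLie.of k (k × k)).symm m).2 • AbelianLie.of k (k × k) (0, 1) := by
  apply (AbelianLie.of k (k × k)).symm.injective
  ext <;> simp

theorem L.hom_ext {f g : L k →ₗ⁅k⁆ G} (ha : f (a k) = g (a k)) (hb : f (b k) = g (b k))
    (hx : f (x k) = g (x k)) : f = g := by
  refine FreeProduct.hom_ext (fun m => ?_) fun m => ?_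
  · rw [M.eq_smul_add_smul m]
    simp only [map_add, map_smul]
    exact congrArg₂ _ (congrArg _ ha) (congrArg _ hb)
  · have hm : m = (AbelianLie.of k k).symm m • AbelianLie.of k k 1 := by
      apply (AbelianLie.of k k).symm.injective
      simp
    rw [hm]
    simp only [map_smul]
    exact congrArg _ hx

end Relations

/-! ### The monomial models and the presentation of `S`. -/

section Presentation

variable (k : Type*) [Field k]

/-- The exponents of the nonconstant monomials in two variables. -/
abbrev Exponents := {p : ℕ × ℕ // p ≠ 0}

/-- Multiplication by the first variable. -/
def shift₁ (p : ℕ × ℕ) : ℕ × ℕ := (p.1 + 1, p.2)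

/-- Multiplication by the second variable. -/
def shift₂ (p : ℕ × ℕ) : ℕ × ℕ := (p.1, p.2 + 1)

/-- Multiplication by the first variable, on nonconstant monomials. -/
def Exponents.shift₁ (p : Exponents) : Exponents := ⟨LieKurosh.shift₁ p, by simp [LieKurosh.shift₁]⟩

/-- Multiplication by the second variable, on nonconstant monomials. -/
def Exponents.shift₂ (p : Exponents) : Exponents := ⟨LieKurosh.shift₂ p, by simp [LieKurosh.shift₂]⟩

theorem shift_comm (p : ℕ × ℕ) : shift₁ (shift₂ p) = shift₂ (shift₁ p) := rfl

theorem Exponents.shift_comm (p : Exponents) : p.shift₂.shift₁ = p.shift₁.shift₂ := rfl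

theorem Exponents.coe_shift₁ (p : Exponents) :
    (p.shift₁ : ℕ × ℕ) = LieKurosh.shift₁ (p : ℕ × ℕ) := rfl

theorem Exponents.coe_shift₂ (p : Exponents) :
    (p.shift₂ : ℕ × ℕ) = LieKurosh.shift₂ (p : ℕ × ℕ) := rfl

/-- The homomorphism from the presented algebra to its semidirect product model. -/
def Pres.toModel : Pres k →ₗ⁅k⁆ Model k Exponents.shift_comm :=
  Pres.lift (fun
    | .a => Model.a k Exponents.shift_comm
    | .b => Model.b k Exponents.shift_comm
    -- The sign comes from `[x, a] = -[a, x]`: the generators are iterated left brackets by `a` and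
    -- `b`, with `x` at exponent zero.
    | .z => -Model.gen k Exponents.shift_comm ⟨(1, 0), by simp⟩
    | .t => -Model.gen k Exponents.shift_comm ⟨(0, 1), by simp⟩)
    (by
      rw [neg_lie, neg_lie, lie_skew, lie_skew, Model.a_lie_gen, Model.b_lie_gen]
      rfl)
    (Model.a_lie_b k _)

section Monomials

variable {G : Type*} [LieRing G]

/-- With `r = x` this is the relation between `z` and `t` in `L`. -/
theorem lie_lie_comm_of_lie_eq_zero {p q : G} (h : ⁅p, q⁆ = 0) (r : G) :
    ⁅⁅r, p⁆, q⁆ = ⁅⁅r, q⁆, p⁆ := by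
  have := leibniz_lie r p q
  rw [h, lie_zero, ← lie_skew p] at this
  rw [← sub_eq_zero, sub_eq_add_neg]
  exact this.symm

/-- For commuting `p`, `q` and elements `z`, `t` with `[z, q] = [t, p]`, the elements indexed by
the nonconstant monomials in two variables that they generate under `ad p` and `ad q`. -/
def monomialElt (p q z t : G) : ℕ × ℕ → G
  -- Pure powers of the second variable come from `t`, all other monomials from `z`. The value at
  -- `(0, 0)` is a dummy.
  | (0, j) => (fun v => ⁅q, v⁆)^[j - 1] (-t)
  | (i + 1, j) => (fun v => ⁅p, v⁆)^[i] ((fun v => ⁅q, v⁆)^[j] (-z))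

variable {p q z t : G} (h : ⁅p, q⁆ = 0)

include h

theorem ad_commute : Function.Commute (fun v : G => ⁅p, v⁆) (fun v : G => ⁅q, v⁆) :=
  fun v => by
    simp only
    rw [leibniz_lie, h, zero_lie, zero_add]

/-- The relation `h'` enters only at pure powers of the second variable, where it converts an
element built from `t` into one built from `z`. -/
theorem lie_monomialElt₁ (h' : ⁅z, q⁆ = ⁅t, p⁆) (m : ℕ × ℕ) (hm : m ≠ 0) :
    ⁅p, monomialElt p q z t m⁆ = monomialElt p q z t (shift₁ m) := by
  obtain ⟨_ | i, j⟩ := m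
  · obtain _ | j := j
    · exact absurd rfl hm
    · simp only [shift₁, monomialElt, zero_add, Function.iterate_zero, id, Nat.add_sub_cancel]
      have := (ad_commute h).iterate_right j (-t)
      rw [this, Function.iterate_succ_apply, lie_neg, lie_neg, lie_skew, lie_skew, h']
  · simp only [shift₁, monomialElt]
    rw [Function.iterate_succ_apply']

theorem lie_monomialElt₂ (m : ℕ × ℕ) (hm : m ≠ 0) :
    ⁅q, monomialElt p q z t m⁆ = monomialElt p q z t (shift₂ m) := by
  obtain ⟨_ | i, j⟩ := m
  · obtain _ | j := j
    · exact absurd rfl hm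
    · simp only [shift₂, monomialElt, Nat.add_sub_cancel]
      rw [Function.iterate_succ_apply']
  · simp only [shift₂, monomialElt]
    have := (ad_commute h).symm.iterate_right i ((fun v => ⁅q, v⁆)^[j] (-z))
    rw [Function.iterate_succ_apply', this]

end Monomials

/-- The inverse of `Pres.toModel`. -/
def Pres.ofModel : Model k Exponents.shift_comm →ₗ⁅k⁆ Pres k :=
  Model.lift (Pres.of k .a) (Pres.of k .b) 
    (fun m => monomialElt (Pres.of k .a) (Pres.of k .b) (Pres.of k .z) (Pres.of k .t) m)
    (Pres.a_lie_b k) (fun m => lie_monomialElt₁ (Pres.a_lie_b k) (Pres.z_lie_b k) m m.2)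
    (fun m => lie_monomialElt₂ (Pres.a_lie_b k) m m.2)

/-- This composite can be checked on four generators, and it already gives injectivity of
`Pres.toModel`; the other composite is not needed. -/
theorem Pres.ofModel_comp_toModel : (Pres.ofModel k).comp (Pres.toModel k) = LieHom.id :=
  Presented.hom_ext fun g => by
    rw [LieHom.comp_apply, Pres.toModel, Pres.lift_of]
    cases g <;> simp only [map_neg, Pres.ofModel] <;> simp [monomialElt]

theorem Pres.toModel_injective : Function.Injective (Pres.toModel k) :=
  Function.LeftInverse.injective (g := Pres.ofModel k)
    fun p => LieHom.congr_fun (Pres.ofModel_comp_toModel k) p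

/-- The homomorphism from `L` to its semidirect product model. -/
def L.toModel : L k →ₗ⁅k⁆ Model k shift_comm :=
  L.lift (Model.a k shift_comm) (Model.b k shift_comm) (Model.gen k shift_comm 0)
    (Model.a_lie_b k shift_comm)

/-- The canonical map of the presented algebra to `L`. -/
def Pres.toL : Pres k →ₗ⁅k⁆ L k :=
  Pres.lift (genInL k) (lie_lie_comm_of_lie_eq_zero (LieKurosh.a_lie_b k) (x k))
    (LieKurosh.a_lie_b k)

@[simp]
theorem Pres.toL_of (g : Gen) : Pres.toL k (Pres.of k g) = genInL k g :=
  Pres.lift_of _ _ _ g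

/-- Followed by `L.toModel`, the map becomes the composite of two injections: `Pres.toModel` and the
inclusion of the model on nonconstant monomials. Injectivity of `L.toModel` itself is not required.
-/
theorem Pres.toL_injective : Function.Injective (Pres.toL k) := by
  let i : Model k Exponents.shift_comm →ₗ⁅k⁆ Model k shift_comm :=
    Model.map _ Subtype.val Exponents.coe_shift₁ Exponents.coe_shift₂
  have hi : Function.Injective i := Model.map_injective _ _ _ Subtype.val_injective
  have h : (L.toModel k).comp (Pres.toL k) = i.comp (Pres.toModel k) := Presented.hom_ext fun g => by
    rw [LieHom.comp_apply, LieHom.comp_apply, Pres.toModel, Pres.toL_of, Pres.lift_of]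
    cases g <;> simp only [genInL, LieHom.map_lie, L.toModel, L.lift_a, L.lift_b, L.lift_x, i]
    · exact (Model.map_a _ _ _).symm
    · exact (Model.map_b _ _ _).symm
    · rw [← lie_skew, Model.a_lie_gen, map_neg, Model.map_gen]; rfl
    · rw [← lie_skew, Model.b_lie_gen, map_neg, Model.map_gen]; rfl
  have hcomp := hi.comp (Pres.toModel_injective k)
  rw [← LieHom.coe_comp, ← h, LieHom.coe_comp] at hcomp
  exact hcomp.of_comp

theorem Pres.range_toL : (Pres.toL k).range = S k := by
  have h : {a k, b k, ⁅x k, a k⁆, ⁅x k, b k⁆} = Set.range (genInL k) := by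
    ext y
    constructor
    · rintro (rfl | rfl | rfl | rfl)
      exacts [⟨.a, rfl⟩, ⟨.b, rfl⟩, ⟨.z, rfl⟩, ⟨.t, rfl⟩]
    · rintro ⟨_ | _ | _ | _, rfl⟩ <;> simp [genInL]
  rw [S, h]
  apply le_antisymm
  · rintro _ ⟨p, rfl⟩
    have hp : p ∈ LieSubalgebra.lieSpan k (Pres k) (Set.range (Presented.of k (relators k))) := by
      rw [Presented.lieSpan_range_of]; trivial
    have : LieSubalgebra.lieSpan k (Pres k) (Set.range (Presented.of k (relators k))) ≤
        (LieSubalgebra.lieSpan k (L k) (Set.range (genInL k))).comap (Pres.toL k) := by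
      rw [LieSubalgebra.lieSpan_le]
      rintro _ ⟨g, rfl⟩
      rw [SetLike.mem_coe, LieSubalgebra.mem_comap, Pres.toL_of]
      exact LieSubalgebra.subset_lieSpan ⟨g, rfl⟩
    exact this hp
  · rw [LieSubalgebra.lieSpan_le]
    rintro _ ⟨g, rfl⟩
    exact ⟨Pres.of k g, Pres.toL_of k g⟩

/-- The presentation of `S`. -/
def Pres.equivS : Pres k ≃ₗ⁅k⁆ S k :=
  (LieEquiv.ofInjective (Pres.toL k) (Pres.toL_injective k)).trans
    (LieEquiv.ofEq _ _ (by rw [Pres.range_toL]))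

theorem Pres.equivS_of (g : Gen) : (Pres.equivS k (Pres.of k g) : L k) = genInL k g :=
  Pres.toL_of k g

theorem range_inl_le_S : (FreeProduct.inl k (M k) (N k)).range ≤ S k := by
  rintro _ ⟨m, rfl⟩
  rw [M.eq_smul_add_smul m]
  change FreeProduct.inl k (M k) (N k) (_ + _) ∈ S k
  rw [map_add, map_smul, map_smul]
  exact add_mem (SMulMemClass.smul_mem _ (LieSubalgebra.subset_lieSpan (by simp [a])))
    (SMulMemClass.smul_mem _ (LieSubalgebra.subset_lieSpan (by simp [b])))

end Presentation

/-! ### Brackets of spans and sums of subspaces. -/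

section Generic

variable {k : Type*} [Field k] {G : Type*} [LieRing G] [LieAlgebra k G] {W : Submodule k G}

theorem lie_mem_of_eq_zero_left {y : G} (hy : y = 0) (z : G) : ⁅y, z⁆ ∈ W := by
  rw [hy, zero_lie]; exact zero_mem _

theorem lie_mem_of_eq_zero_right (y : G) {z : G} (hz : z = 0) : ⁅y, z⁆ ∈ W := by
  rw [hz, lie_zero]; exact zero_mem _

theorem lie_mem_of_mem_span {s : Set G} {z : G} (h : ∀ y ∈ s, ⁅y, z⁆ ∈ W) {y : G}
    (hy : y ∈ Submodule.span k s) : ⁅y, z⁆ ∈ W := by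
  induction hy using Submodule.span_induction with
  | mem y hy => exact h y hy
  | zero => rw [zero_lie]; exact zero_mem _
  | add y y' _ _ hy hy' => rw [add_lie]; exact add_mem hy hy'
  | smul c y _ hy => rw [smul_lie]; exact Submodule.smul_mem _ c hy

theorem lie_mem_of_mem_iSup {ι : Type*} {V : ι → Submodule k G}
    (h : ∀ i j, ∀ y ∈ V i, ∀ z ∈ V j, ⁅y, z⁆ ∈ W) {y z : G} (hy : y ∈ ⨆ i, V i)
    (hz : z ∈ ⨆ i, V i) : ⁅y, z⁆ ∈ W := by
  induction hy using Submodule.iSup_induction' with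
  | mem i y hy =>
    induction hz using Submodule.iSup_induction' with
    | mem j z hz => exact h i j y hy z hz
    | zero => rw [lie_zero]; exact zero_mem _
    | add z z' _ _ hz hz' => rw [lie_add]; exact add_mem hz hz'
  | zero => rw [zero_lie]; exact zero_mem _
  | add y y' _ _ hy hy' => rw [add_lie]; exact add_mem hy hy'

theorem lie_lie_mem {u v z : G} (h1 : ⁅u, ⁅v, z⁆⁆ ∈ W) (h2 : ⁅v, ⁅u, z⁆⁆ ∈ W) :
    ⁅⁅u, v⁆, z⁆ ∈ W := by
  rw [lie_lie]; exact sub_mem h1 h2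

end Generic

/-! ### The grading of `L` and its graded subalgebras. -/

section Grading

variable (k : Type*) [Field k]

open scoped TensorProduct Polynomial

/-- The coaction of the multiplicative group defining the grading of `L`. -/
def coaction : L k →ₗ⁅k⁆ k[X] ⊗[k] L k :=
  L.lift (Polynomial.X ⊗ₜ a k) (Polynomial.X ⊗ₜ b k) (Polynomial.X ⊗ₜ x k) (by
    rw [LieAlgebra.ExtendScalars.bracket_tmul, a_lie_b, TensorProduct.tmul_zero])

variable {k} in
-- The coaction is a Lie homomorphism giving each generator weight `X`, so weights multiply under
-- brackets. Reading off the coefficient of `X ^ i` then separates the degrees.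
theorem coaction_apply {i : ℕ} {y : L k} (hy : y ∈ grading k i) :
    coaction k y = (Polynomial.X ^ i : k[X]) ⊗ₜ y := by
  have h1 : ∀ y ∈ Submodule.span k {a k, b k, x k},
      coaction k y = (Polynomial.X : k[X]) ⊗ₜ y := by
    intro y hy
    induction hy using Submodule.span_induction with
    | mem y hy => rcases hy with rfl | rfl | rfl <;> simp [coaction]
    | zero => simp
    | add y z _ _ hy hz => rw [map_add, hy, hz, TensorProduct.tmul_add]
    | smul c y _ hy => rw [map_smul, hy, TensorProduct.tmul_smul]
  induction i using Nat.strong_induction_on generalizing y with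
  | _ i ih =>
    obtain _ | _ | i := i
    · rw [grading, Submodule.mem_bot] at hy
      rw [hy, map_zero, TensorProduct.tmul_zero]
    · rw [zero_add, pow_one]; exact h1 y hy
    · rw [grading] at hy
      induction hy using Submodule.span_induction with
      | mem y hy =>
        obtain ⟨u, hu, v, hv, rfl⟩ := hy
        rw [LieHom.map_lie, h1 u hu, ih (i + 1) (by omega) hv,
          LieAlgebra.ExtendScalars.bracket_tmul, ← pow_succ']
      | zero => simp
      | add y z _ _ hy hz => rw [map_add, hy, hz, TensorProduct.tmul_add]
      | smul c y _ hy => rw [map_smul, hy, TensorProduct.tmul_smul]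

/-- The projection of `L` onto its component of degree `i`. -/
def component (i : ℕ) : L k →ₗ[k] L k :=
  (TensorProduct.lid k (L k) : k ⊗[k] L k →ₗ[k] L k) ∘ₗ
    (Polynomial.lcoeff k i).rTensor (L k) ∘ₗ (coaction k : L k →ₗ[k] k[X] ⊗[k] L k)

variable {k}

theorem component_apply_of_mem {i j : ℕ} {y : L k} (hy : y ∈ grading k j) :
    component k i y = if j = i then y else 0 := by
  simp only [component, LinearMap.comp_apply, LieHom.coe_toLinearMap]
  rw [coaction_apply hy]
  simp [Polynomial.coeff_X_pow, eq_comm]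

theorem lie_mem_grading_one {j : ℕ} {y z : L k} (hy : y ∈ grading k 1) (hz : z ∈ grading k j) :
    ⁅y, z⁆ ∈ grading k (j + 1) := by
  cases j with
  | zero => exact lie_mem_of_eq_zero_right y hz
  | succ j => exact Submodule.subset_span ⟨y, hy, z, hz, rfl⟩

/-- The Jacobi identity, applied to a left argument `[u, v]` with `u` of degree one, lowers the
degree of the left argument. -/
theorem lie_mem_grading (i j : ℕ) (y : L k) (hy : y ∈ grading k i) (z : L k)
    (hz : z ∈ grading k j) : ⁅y, z⁆ ∈ grading k (i + j) := by
  induction i using Nat.strong_induction_on generalizing y z j with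
  | _ i ih =>
    obtain _ | _ | i := i
    · exact lie_mem_of_eq_zero_left hy z
    · rw [zero_add, add_comm]
      exact lie_mem_grading_one hy hz
    · refine lie_mem_of_mem_span ?_ hy
      rintro _ ⟨u, hu, v, hv, rfl⟩
      have h1 := lie_mem_grading_one hu (ih (i + 1) (by omega) j v hv z hz)
      have h2 := ih (i + 1) (by omega) (j + 1) v hv ⁅u, z⁆ (lie_mem_grading_one hu hz)
      rw [show i + 1 + j + 1 = i + 1 + 1 + j by omega] at h1
      rw [show i + 1 + (j + 1) = i + 1 + 1 + j by omega] at h2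
      exact lie_lie_mem h1 h2

theorem iSup_grading : ⨆ i, grading k i = ⊤ := by
  let T : LieSubalgebra k (L k) :=
    { toSubmodule := ⨆ i, grading k i
      lie_mem' := lie_mem_of_mem_iSup fun i j y hy z hz =>
        Submodule.mem_iSup_of_mem _ (lie_mem_grading i j y hy z hz) }
  have ha : a k ∈ T := Submodule.mem_iSup_of_mem 1 (Submodule.subset_span (by simp))
  have hb : b k ∈ T := Submodule.mem_iSup_of_mem 1 (Submodule.subset_span (by simp))
  have hx : x k ∈ T := Submodule.mem_iSup_of_mem 1 (Submodule.subset_span (by simp))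
  let f : L k →ₗ⁅k⁆ T := L.lift ⟨a k, ha⟩ ⟨b k, hb⟩ ⟨x k, hx⟩ (Subtype.ext (a_lie_b k))
  have hf : T.incl.comp f = LieHom.id := L.hom_ext (by simp [f]) (by simp [f]) (by simp [f])
  refine eq_top_iff.2 fun y _ => ?_
  have := LieHom.congr_fun hf y
  simp only [LieHom.comp_apply, LieHom.id_apply] at this
  rw [← this]
  exact (f y).2

theorem isPositiveGrading : IsPositiveGrading (grading k) where
  zero := rfl
  isInternal := by
    refine ⟨?_, ?_⟩
    · rw [injective_iff_map_eq_zero]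
      intro y hy
      ext i
      -- The projections recover each summand from the total, so the sum is direct.
      have h : component k i (DirectSum.coeAddMonoidHom (grading k) y) = y i := by
        clear hy
        induction y using DirectSum.induction_on with
        | zero => simp
        | of j y =>
          rw [DirectSum.coeAddMonoidHom_of, component_apply_of_mem y.2, DirectSum.coe_of_apply]
          split_ifs <;> simp
        | add y z hy hz => rw [map_add, map_add, hy, hz]; rfl
      rw [← h, hy, map_zero]
      rfl
    · exact LinearMap.range_eq_top.1
        ((DirectSum.range_coeLinearMap (A := grading k)).trans iSup_grading)
  lie_mem := lie_mem_grading

theorem isGradedSubalgebra_lieSpan {s : Set (L k)} (hs : ∀ y ∈ s, ∃ i, y ∈ grading k i) :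
    IsGradedSubalgebra (grading k) (LieSubalgebra.lieSpan k (L k) s) := by
  set C := LieSubalgebra.lieSpan k (L k) s
  refine le_antisymm ?_ (iSup_le fun i => inf_le_left)
  intro y hy
  change y ∈ C at hy
  induction hy using LieSubalgebra.lieSpan_induction with
  | mem y hy =>
    obtain ⟨i, hi⟩ := hs y hy
    exact Submodule.mem_iSup_of_mem i ⟨LieSubalgebra.subset_lieSpan hy, hi⟩
  | zero => exact zero_mem _
  | add y z _ _ hy hz => exact add_mem hy hz
  | smul c y _ hy => exact Submodule.smul_mem _ c hy
  | lie y z _ _ hy hz =>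
    exact lie_mem_of_mem_iSup (V := fun i => C.toSubmodule ⊓ grading k i)
      (fun i j y hy z hz => Submodule.mem_iSup_of_mem (i + j) (show _ ∈ C.toSubmodule ⊓ grading k (i + j) from
        ⟨C.lie_mem hy.1 hz.1, lie_mem_grading i j y hy.2 z hz.2⟩)) hy hz

theorem isGradedSubalgebra_S : IsGradedSubalgebra (grading k) (S k) := by
  have ha : a k ∈ grading k 1 := Submodule.subset_span (by simp)
  have hb : b k ∈ grading k 1 := Submodule.subset_span (by simp)
  have hx : x k ∈ grading k 1 := Submodule.subset_span (by simp)
  refine isGradedSubalgebra_lieSpan ?_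
  rintro y (rfl | rfl | rfl | rfl)
  exacts [⟨1, ha⟩, ⟨1, hb⟩, ⟨2, lie_mem_grading_one hx ha⟩, ⟨2, lie_mem_grading_one hx hb⟩]

/-- A nonzero graded subalgebra is not perfect. -/
theorem exists_hom_ne_zero_of_isGradedSubalgebra {C : LieSubalgebra k (L k)} (hC : C ≠ ⊥)
    (hgr : IsGradedSubalgebra (grading k) C) : ∃ χ : C →ₗ⁅k⁆ AbelianLie k, χ ≠ 0 := by
  classical
  -- The character is a functional on the lowest nonzero degree `i` of `C`.
  have hex : ∃ i, C.toSubmodule ⊓ grading k i ≠ ⊥ := by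
    by_contra! h
    apply hC
    rw [← LieSubalgebra.toSubmodule_inj, hgr]
    simp [h]
  set i := Nat.find hex with hi
  obtain ⟨w, hw, hw0⟩ := Submodule.exists_mem_ne_zero_of_ne_bot (Nat.find_spec hex)
  have hmin : ∀ {j y}, y ∈ C.toSubmodule ⊓ grading k j → y ≠ 0 → i ≤ j := fun {j y} hy hy0 =>
    Nat.find_min' hex fun h => hy0 (by rw [h] at hy; exact hy)
  have hipos : i ≠ 0 := fun h => hw0 (by
    have := hw.2
    rw [← hi, h] at this
    exact this)
  -- Nonzero homogeneous elements of `C` have degree at least `i`, so their brackets have degree at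
  -- least `2 * i`, which exceeds `i` as `i` is positive.
  have hlie : ∀ y ∈ C, ∀ z ∈ C, component k i ⁅y, z⁆ = 0 := by
    intro y hy z hz
    rw [← LieSubalgebra.mem_toSubmodule, hgr] at hy hz
    refine LinearMap.mem_ker.1 (lie_mem_of_mem_iSup (fun j l y hy z hz => ?_) hy hz)
    rcases eq_or_ne y 0 with hy0 | hy0
    · exact lie_mem_of_eq_zero_left hy0 z
    rcases eq_or_ne z 0 with hz0 | hz0
    · exact lie_mem_of_eq_zero_right y hz0
    rw [LinearMap.mem_ker, component_apply_of_mem (lie_mem_grading j l y hy.2 z hz.2), if_neg]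
    have := hmin hy hy0
    have := hmin hz hz0
    omega
  obtain ⟨f, hf⟩ := Module.Projective.exists_dual_ne_zero k hw0
  let χ : C →ₗ⁅k⁆ AbelianLie k :=
    { toLinearMap := (AbelianLie.of k k : k →ₗ[k] AbelianLie k) ∘ₗ f ∘ₗ component k i ∘ₗ
        C.toSubmodule.subtype
      map_lie' := fun {y z} => by
        change AbelianLie.of k k (f (component k i ⁅(y : L k), (z : L k)⁆)) = 0
        rw [hlie y y.2 z z.2, map_zero, map_zero] }
  refine ⟨χ, fun h => hf ?_⟩
  have h' : f (component k i w) = 0 := LieHom.congr_fun h ⟨w, hw.1⟩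
  rwa [component_apply_of_mem hw.2, if_pos hi.symm] at h'

end Grading

/-! ### The Heisenberg algebra as a detector of quadratic relations. -/

section Heisenberg

variable (k : Type*) [Field k]

/-- The three-dimensional Heisenberg Lie algebra. -/
def Heisenberg := k × k × k

instance : AddCommGroup (Heisenberg k) := inferInstanceAs (AddCommGroup (k × k × k))

instance : Module k (Heisenberg k) := inferInstanceAs (Module k (k × k × k))

instance : LieRing (Heisenberg k) where
  bracket p q := (0, 0, p.1 * q.2.1 - q.1 * p.2.1)
  add_lie p q r := by
    refine Prod.ext (add_zero _).symm (Prod.ext (add_zero _).symm ?_)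
    change (p.1 + q.1) * r.2.1 - r.1 * (p.2.1 + q.2.1) =
      p.1 * r.2.1 - r.1 * p.2.1 + (q.1 * r.2.1 - r.1 * q.2.1)
    ring
  lie_add p q r := by
    refine Prod.ext (add_zero _).symm (Prod.ext (add_zero _).symm ?_)
    change p.1 * (q.2.1 + r.2.1) - (q.1 + r.1) * p.2.1 =
      p.1 * q.2.1 - q.1 * p.2.1 + (p.1 * r.2.1 - r.1 * p.2.1)
    ring
  lie_self p := Prod.ext rfl (Prod.ext rfl (sub_self _))
  leibniz_lie p q r := by
    refine Prod.ext (add_zero _).symm (Prod.ext (add_zero _).symm ?_)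
    change p.1 * 0 - 0 * p.2.1 = 0 * r.2.1 - r.1 * 0 + (q.1 * 0 - 0 * q.2.1)
    ring

instance : LieAlgebra k (Heisenberg k) where
  lie_smul c p q := by
    refine Prod.ext (smul_zero _).symm (Prod.ext (smul_zero _).symm ?_)
    change p.1 * (c * q.2.1) - (c * q.1) * p.2.1 = c * (p.1 * q.2.1 - q.1 * p.2.1)
    ring

namespace Heisenberg

/-- The first coordinate of the abelianization. -/
def fst : Heisenberg k →ₗ⁅k⁆ AbelianLie k where
  toFun p := AbelianLie.of k k p.1
  map_add' _ _ := rfl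
  map_smul' _ _ := rfl
  map_lie' := rfl

/-- The second coordinate of the abelianization. -/
def snd : Heisenberg k →ₗ⁅k⁆ AbelianLie k where
  toFun p := AbelianLie.of k k p.2.1
  map_add' _ _ := rfl
  map_smul' _ _ := rfl
  map_lie' := rfl

variable {k} {C : Type*} [LieRing C] [LieAlgebra k C]

/-- A homomorphism to the first coordinate axis. -/
def inl (χ : C →ₗ⁅k⁆ AbelianLie k) : C →ₗ⁅k⁆ Heisenberg k where
  toFun c := ((AbelianLie.of k k).symm (χ c), 0, 0)
  map_add' c d := by
    refine Prod.ext ?_ (Prod.ext (add_zero _).symm (add_zero _).symm)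
    change (AbelianLie.of k k).symm (χ (c + d)) = _
    rw [map_add, map_add]; rfl
  map_smul' r c := by
    refine Prod.ext ?_ (Prod.ext (smul_zero _).symm (smul_zero _).symm)
    change (AbelianLie.of k k).symm (χ (r • c)) = _
    rw [map_smul, map_smul]; rfl
  map_lie' {c d} := by
    refine Prod.ext ?_ (Prod.ext rfl ?_)
    · change (AbelianLie.of k k).symm (χ ⁅c, d⁆) = 0
      rw [LieHom.map_lie]; rfl
    · change (0 : k) = _ * 0 - _ * 0
      ring

/-- A homomorphism to the second coordinate axis. -/
def inr (χ : C →ₗ⁅k⁆ AbelianLie k) : C →ₗ⁅k⁆ Heisenberg k where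
  toFun c := (0, (AbelianLie.of k k).symm (χ c), 0)
  map_add' c d := by
    refine Prod.ext (add_zero _).symm (Prod.ext ?_ (add_zero _).symm)
    change (AbelianLie.of k k).symm (χ (c + d)) = _
    rw [map_add, map_add]; rfl
  map_smul' r c := by
    refine Prod.ext (smul_zero _).symm (Prod.ext ?_ (smul_zero _).symm)
    change (AbelianLie.of k k).symm (χ (r • c)) = _
    rw [map_smul, map_smul]; rfl
  map_lie' {c d} := by
    refine Prod.ext rfl (Prod.ext ?_ ?_)
    · change (AbelianLie.of k k).symm (χ ⁅c, d⁆) = 0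
      rw [LieHom.map_lie]; rfl
    · change (0 : k) = 0 * _ - 0 * _
      ring

/-- Equal brackets have equal determinants of the coordinates in the abelianization. -/
theorem coord_eq {p q r s : C} (Φ : C →ₗ⁅k⁆ Heisenberg k) (h : ⁅p, q⁆ = ⁅r, s⁆) :
    (Φ p).1 * (Φ q).2.1 - (Φ q).1 * (Φ p).2.1 = (Φ r).1 * (Φ s).2.1 - (Φ s).1 * (Φ r).2.1 := by
  have := congrArg (fun v => (Φ v).2.2) h
  simp only [LieHom.map_lie] at this
  exact this

end Heisenberg

end Heisenberg

/-! ### Free product decompositions of the presented algebra. -/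

section Decompositions

variable {k : Type*} [Field k]

/-- By `h₁`, the `(a, b)`-parts of members of `X` and of `Y` are always parallel; as together they
fill the plane, one of the two sets has zero `(a, b)`-part. The other then realizes both basis
vectors of the plane, and `h₂` against these kills the `z` and `t` coordinates. -/
theorem eq_zero_or_eq_zero_of_decomposition {X Y : Set (Gen → k)}
    (hdec : ∀ c : Gen → k, ∃ F ∈ X, ∃ G ∈ Y, F + G = c)
    (h₁ : ∀ F ∈ X, ∀ G ∈ Y, F .a * G .b = F .b * G .a)
    (h₂ : ∀ F ∈ X, ∀ G ∈ Y, F .z * G .b - F .b * G .z = F .t * G .a - F .a * G .t) :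
    (∀ F ∈ X, F = 0) ∨ ∀ G ∈ Y, G = 0 := by
  have hzero : ∀ F : Gen → k, F .a = 0 → F .b = 0 → F .z = 0 → F .t = 0 → F = 0 :=
    fun F ha hb hz ht => funext fun g => by cases g <;> assumption
  obtain ⟨F₁, hF₁, G₁, hG₁, e₁⟩ := hdec (fun | .a => 1 | .b => 0 | .z => 0 | .t => 0)
  obtain ⟨F₂, hF₂, G₂, hG₂, e₂⟩ := hdec (fun | .a => 0 | .b => 1 | .z => 0 | .t => 0)
  have e₁a : F₁ .a + G₁ .a = 1 := congrFun e₁ .a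
  have e₁b : F₁ .b + G₁ .b = 0 := congrFun e₁ .b
  have e₂a : F₂ .a + G₂ .a = 0 := congrFun e₂ .a
  have e₂b : F₂ .b + G₂ .b = 1 := congrFun e₂ .b
  have key : (∀ G ∈ Y, G .a = 0 ∧ G .b = 0) ∨ ∀ F ∈ X, F .a = 0 ∧ F .b = 0 := by
    by_contra! hcon
    obtain ⟨⟨G, hG, hG0⟩, F, hF, hF0⟩ := hcon
    -- If both sets had nonzero `(a, b)`-parts, everything would lie on the line through that of
    -- `G`, whereas the sums fill the plane.
    have hX : ∀ F' ∈ X, F' .a * G .b = F' .b * G .a := fun F' hF' => h₁ F' hF' G hG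
    have hY : ∀ G' ∈ Y, G' .a * G .b = G' .b * G .a := by
      intro G' hG'
      have h3 := h₁ F hF G' hG'
      have h4 := h₁ F hF G hG
      rcases eq_or_ne (F .a) 0 with h0 | h0
      · apply mul_left_cancel₀ (hF0 h0)
        linear_combination G' .b * h4 - G .b * h3
      · apply mul_left_cancel₀ h0
        linear_combination G' .a * h4 - G .a * h3
    refine hG0 ?_ ?_
    · linear_combination G .b * e₂a - G .a * e₂b - hX F₂ hF₂ - hY G₂ hG₂
    · linear_combination hX F₁ hF₁ + hY G₁ hG₁ - G .b * e₁a + G .a * e₁b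
  rcases key with h | h
  · refine Or.inr fun G hG => hzero G (h G hG).1 (h G hG).2 ?_ ?_
    · have := h₂ F₂ hF₂ G hG
      rw [(h _ hG₂).1, add_zero] at e₂a
      rw [(h _ hG₂).2, add_zero] at e₂b
      rw [(h G hG).1, (h G hG).2, e₂a, e₂b] at this
      linear_combination -this
    · have := h₂ F₁ hF₁ G hG
      rw [(h _ hG₁).1, add_zero] at e₁a
      rw [(h _ hG₁).2, add_zero] at e₁b
      rw [(h G hG).1, (h G hG).2, e₁a, e₁b] at this
      linear_combination this
  · refine Or.inl fun F hF => hzero F (h F hF).1 (h F hF).2 ?_ ?_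
    · have := h₂ F hF G₂ hG₂
      rw [(h _ hF₂).1, zero_add] at e₂a
      rw [(h _ hF₂).2, zero_add] at e₂b
      rw [(h F hF).1, (h F hF).2, e₂a, e₂b] at this
      linear_combination this
    · have := h₂ F hF G₁ hG₁
      rw [(h _ hF₁).1, zero_add] at e₁a
      rw [(h _ hF₁).2, zero_add] at e₁b
      rw [(h F hF).1, (h F hF).2, e₁a, e₁b] at this
      linear_combination -this

variable {C D : Type*} [LieRing C] [LieAlgebra k C] [LieRing D] [LieAlgebra k D]

/-- The values on the generators of a homomorphism to the one-dimensional Lie algebra, with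
respect to a decomposition. -/
def values (e : Pres k ≃ₗ⁅k⁆ FreeProduct k C D) (χ : C →ₗ⁅k⁆ AbelianLie k)
    (η : D →ₗ⁅k⁆ AbelianLie k) (g : Gen) : k :=
  (AbelianLie.of k k).symm (FreeProduct.lift χ η (e (Pres.of k g)))

theorem values_zero_right_add (e : Pres k ≃ₗ⁅k⁆ FreeProduct k C D) (χ : C →ₗ⁅k⁆ AbelianLie k)
    (η : D →ₗ⁅k⁆ AbelianLie k) : values e χ 0 + values e 0 η = values e χ η := by
  let s : FreeProduct k C D →ₗ⁅k⁆ AbelianLie k :=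
    { toLinearMap := (FreeProduct.lift χ 0 : FreeProduct k C D →ₗ⁅k⁆ AbelianLie k).toLinearMap +
        (FreeProduct.lift 0 η : FreeProduct k C D →ₗ⁅k⁆ AbelianLie k).toLinearMap
      map_lie' := fun {p q} => by
        change FreeProduct.lift χ 0 ⁅p, q⁆ + FreeProduct.lift 0 η ⁅p, q⁆ = 0
        rw [LieHom.map_lie, LieHom.map_lie]
        exact add_zero 0 }
  have h : s = FreeProduct.lift χ η := FreeProduct.hom_ext
    (fun c => by
      change FreeProduct.lift χ 0 _ + FreeProduct.lift 0 η _ = _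
      simp)
    (fun d => by
      change FreeProduct.lift χ 0 _ + FreeProduct.lift 0 η _ = _
      simp)
  funext g
  rw [Pi.add_apply, values, values, values, ← map_add, ← h]
  rfl

/-- The relators are combinations of brackets, so they restrict no homomorphism to an abelian
algebra; a character of a free product is a pair of characters of the factors. -/
theorem exists_values_eq (e : Pres k ≃ₗ⁅k⁆ FreeProduct k C D) (c : Gen → k) :
    ∃ χ η, values e χ η = c := by
  let f : Pres k →ₗ⁅k⁆ AbelianLie k := Pres.lift (fun g => AbelianLie.of k k (c g)) rfl rfl
  let g : FreeProduct k C D →ₗ⁅k⁆ AbelianLie k := f.comp (e.symm : FreeProduct k C D →ₗ⁅k⁆ Pres k)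
  refine ⟨g.comp (FreeProduct.inl k C D), g.comp (FreeProduct.inr k C D), funext fun i => ?_⟩
  have h : FreeProduct.lift (g.comp (FreeProduct.inl k C D)) (g.comp (FreeProduct.inr k C D)) = g :=
    FreeProduct.hom_ext (fun _ => FreeProduct.lift_inl _ _ _) fun _ => FreeProduct.lift_inr _ _ _
  rw [values, h]
  change (AbelianLie.of k k).symm (f (e.symm (e (Pres.of k i)))) = c i
  rw [LieEquiv.symm_apply_apply, Pres.lift_of, LinearEquiv.symm_apply_apply]

theorem eq_zero_of_values_eq_zero (e : Pres k ≃ₗ⁅k⁆ FreeProduct k C D)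
    {χ : C →ₗ⁅k⁆ AbelianLie k} {η : D →ₗ⁅k⁆ AbelianLie k} (h : values e χ η = 0) :
    χ = 0 ∧ η = 0 := by
  have h1 : (FreeProduct.lift χ η).comp (e : Pres k →ₗ⁅k⁆ FreeProduct k C D) = 0 :=
    Presented.hom_ext fun g => (AbelianLie.of k k).symm.injective (congrFun h g)
  have h2 : ∀ p, FreeProduct.lift χ η p = 0 := fun p => by
    have := LieHom.congr_fun h1 (e.symm p)
    rwa [LieHom.comp_apply, LieEquiv.coe_toLieHom, LieEquiv.apply_symm_apply] at this
  refine ⟨LieHom.ext fun c => ?_, LieHom.ext fun d => ?_⟩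
  · rw [← FreeProduct.lift_inl χ η, h2]; rfl
  · rw [← FreeProduct.lift_inr χ η, h2]; rfl

/-- Sending `C` to the first axis of the Heisenberg algebra by `χ` and `D` to the second by `η`
defines a homomorphism on `C * D`; the identity compares central coordinates of the two brackets. -/
theorem values_relation (e : Pres k ≃ₗ⁅k⁆ FreeProduct k C D) (χ : C →ₗ⁅k⁆ AbelianLie k)
    (η : D →ₗ⁅k⁆ AbelianLie k) {g₁ g₂ g₃ g₄ : Gen}
    (h : ⁅Pres.of k g₁, Pres.of k g₂⁆ = ⁅Pres.of k g₃, Pres.of k g₄⁆) :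
    values e χ 0 g₁ * values e 0 η g₂ - values e χ 0 g₂ * values e 0 η g₁ =
      values e χ 0 g₃ * values e 0 η g₄ - values e χ 0 g₄ * values e 0 η g₃ := by
  let Φ : FreeProduct k C D →ₗ⁅k⁆ Heisenberg k :=
    FreeProduct.lift (Heisenberg.inl χ) (Heisenberg.inr η)
  have h1 : (Heisenberg.fst k).comp Φ = FreeProduct.lift χ 0 :=
    FreeProduct.hom_ext (fun c => by simp [Φ]; rfl) (fun d => by simp [Φ]; rfl)
  have h2 : (Heisenberg.snd k).comp Φ = FreeProduct.lift 0 η :=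
    FreeProduct.hom_ext (fun c => by simp [Φ]; rfl) (fun d => by simp [Φ]; rfl)
  simp only [values, ← h1, ← h2]
  exact Heisenberg.coord_eq (Φ.comp (e : Pres k →ₗ⁅k⁆ FreeProduct k C D)) h

/-- If the presented Lie algebra is a free product, then one of the factors is perfect. -/
theorem perfect_or_perfect (e : Pres k ≃ₗ⁅k⁆ FreeProduct k C D) :
    (∀ χ : C →ₗ⁅k⁆ AbelianLie k, χ = 0) ∨ ∀ η : D →ₗ⁅k⁆ AbelianLie k, η = 0 := by
  have h := eq_zero_or_eq_zero_of_decomposition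
    (X := Set.range fun χ : C →ₗ⁅k⁆ AbelianLie k => values e χ 0)
    (Y := Set.range fun η : D →ₗ⁅k⁆ AbelianLie k => values e 0 η)
    (fun c => by
      obtain ⟨χ, η, h⟩ := exists_values_eq e c
      exact ⟨_, ⟨χ, rfl⟩, _, ⟨η, rfl⟩, (values_zero_right_add e χ η).trans h⟩)
    (by
      rintro _ ⟨χ, rfl⟩ _ ⟨η, rfl⟩
      -- The relator `[a, b]` is put in the required form as `[a, b] = [a, a]`.
      have := values_relation e χ η (g₁ := .a) (g₂ := .b) (g₃ := .a) (g₄ := .a)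
        ((Pres.a_lie_b k).trans (lie_self _).symm)
      linear_combination this)
    (by
      rintro _ ⟨χ, rfl⟩ _ ⟨η, rfl⟩
      exact values_relation e χ η (Pres.z_lie_b k))
  refine h.imp (fun h χ => ?_) fun h η => ?_
  · exact (eq_zero_of_values_eq_zero e (h _ ⟨χ, rfl⟩)).1
  · exact (eq_zero_of_values_eq_zero e (h _ ⟨η, rfl⟩)).2

theorem isEmpty_equiv_freeProduct {χ : C →ₗ⁅k⁆ AbelianLie k} (hχ : χ ≠ 0)
    {η : D →ₗ⁅k⁆ AbelianLie k} (hη : η ≠ 0) : IsEmpty (Pres k ≃ₗ⁅k⁆ FreeProduct k C D) :=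
  ⟨fun e => (perfect_or_perfect e).elim (fun h => hχ (h χ)) fun h => hη (h η)⟩

/-- A linear map is a homomorphism of abelian Lie algebras. -/
def AbelianLie.map {V W : Type*} [AddCommGroup V] [Module k V] [AddCommGroup W] [Module k W]
    (f : V →ₗ[k] W) : AbelianLie V →ₗ⁅k⁆ AbelianLie W where
  toLinearMap := f
  map_lie' := map_zero f

/-- If `M` is a free factor of the presented Lie algebra, the other factor is not perfect. -/
theorem exists_hom_ne_zero_of_equiv_freeProduct_M {Q : Type*} [LieRing Q] [LieAlgebra k Q]
    (e : Pres k ≃ₗ⁅k⁆ FreeProduct k (M k) Q) : ∃ η : Q →ₗ⁅k⁆ AbelianLie k, η ≠ 0 := by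
  by_contra! h
  -- Three dimensions are enough: if `Q` had no characters, this surjection would factor through the
  -- two-dimensional `M`.
  let f : Pres k →ₗ⁅k⁆ AbelianLie (k × k × k) := Pres.lift
    (fun
      | .a => AbelianLie.of k _ (1, 0, 0)
      | .b => AbelianLie.of k _ (0, 1, 0)
      | .z => AbelianLie.of k _ (0, 0, 1)
      | .t => 0) rfl rfl
  let g : FreeProduct k (M k) Q →ₗ⁅k⁆ AbelianLie (k × k × k) :=
    f.comp (e.symm : FreeProduct k (M k) Q →ₗ⁅k⁆ Pres k)
  have hQ : ∀ q, g (FreeProduct.inr k (M k) Q q) = 0 := by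
    intro q
    have hcoord : ∀ l : k × k × k →ₗ[k] k, l (g (FreeProduct.inr k (M k) Q q)) = 0 := fun l =>
      LieHom.congr_fun (h ((AbelianLie.map l).comp (g.comp (FreeProduct.inr k (M k) Q)))) q
    exact Prod.ext (hcoord (LinearMap.fst k k (k × k)))
      (Prod.ext (hcoord (LinearMap.fst k k k ∘ₗ LinearMap.snd k k (k × k)))
        (hcoord (LinearMap.snd k k k ∘ₗ LinearMap.snd k k (k × k))))
  have hg : g = (g.comp (FreeProduct.inl k (M k) Q)).comp (FreeProduct.lift LieHom.id 0) :=
    FreeProduct.hom_ext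
      (fun m => (congrArg (fun m => g (FreeProduct.inl k (M k) Q m))
        (FreeProduct.lift_inl LieHom.id 0 m)).symm)
      (fun q => (hQ q).trans ((congrArg (fun m => g (FreeProduct.inl k (M k) Q m))
        (FreeProduct.lift_inr LieHom.id 0 q)).trans
          (map_zero (g.comp (FreeProduct.inl k (M k) Q)))).symm)
  have hsurj : Function.Surjective (g.comp (FreeProduct.inl k (M k) Q)) := by
    rintro ⟨c₁, c₂, c₃⟩
    have hf : f (c₁ • Pres.of k .a + c₂ • Pres.of k .b + c₃ • Pres.of k .z) =
        AbelianLie.of k _ (c₁, c₂, c₃) := by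
      simp only [map_add, map_smul, f, Pres.lift_of]
      simp only [← map_smul, ← map_add]
      simp
    refine ⟨FreeProduct.lift LieHom.id 0
      (e (c₁ • Pres.of k .a + c₂ • Pres.of k .b + c₃ • Pres.of k .z)), ?_⟩
    refine (LieHom.congr_fun hg _).symm.trans (Eq.trans ?_ hf)
    change f (e.symm (e _)) = _
    rw [LieEquiv.symm_apply_apply]
  have : Module.Finite k (M k) := inferInstanceAs (Module.Finite k (k × k))
  have : Module.finrank k (k × k × k) ≤ Module.finrank k (k × k) :=
    LinearMap.finrank_le_finrank_of_surjective
      (f := (g.comp (FreeProduct.inl k (M k) Q)).toLinearMap) hsurj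
  simp at this

theorem exists_hom_M_ne_zero : ∃ χ : M k →ₗ⁅k⁆ AbelianLie k, χ ≠ 0 :=
  ⟨AbelianLie.map (LinearMap.fst k k k), fun h =>
    one_ne_zero (α := k) (LieHom.congr_fun h (AbelianLie.of k (k × k) (1, 0)))⟩

end Decompositions

/-! ### Generation and derivations of enveloping algebras. -/

section Enveloping

attribute [local instance 100] LieRing.ofAssociativeRing

variable (k : Type*) [Field k] {G : Type*} [LieRing G] [LieAlgebra k G]

local notation "𝓤" => UniversalEnvelopingAlgebra k

theorem adjoin_range_ι :
    Algebra.adjoin k (Set.range (UniversalEnvelopingAlgebra.ι k : G → 𝓤 G)) = ⊤ := by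
  set B := Algebra.adjoin k (Set.range (UniversalEnvelopingAlgebra.ι k : G → 𝓤 G))
  let f : G →ₗ⁅k⁆ B :=
    { toFun := fun g => ⟨UniversalEnvelopingAlgebra.ι k g, Algebra.subset_adjoin ⟨g, rfl⟩⟩
      map_add' := fun _ _ => Subtype.ext (map_add _ _ _)
      map_smul' := fun _ _ => Subtype.ext (map_smul _ _ _)
      map_lie' := fun {_ _} => Subtype.ext (LieHom.map_lie _ _ _) }
  have h : B.val.comp (UniversalEnvelopingAlgebra.lift k f) = AlgHom.id k (𝓤 G) := by
    apply UniversalEnvelopingAlgebra.hom_ext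
    ext g
    simp [f]
  refine eq_top_iff.2 fun y _ => ?_
  have := AlgHom.congr_fun h y
  simp only [AlgHom.comp_apply, AlgHom.id_apply] at this
  rw [← this]
  exact (UniversalEnvelopingAlgebra.lift k f y).2

variable {k} in
theorem enveloping_induction {motive : 𝓤 G → Prop} (u : 𝓤 G)
    (ι : ∀ g, motive (UniversalEnvelopingAlgebra.ι k g)) (algebraMap : ∀ c, motive (algebraMap k _ c))
    (add : ∀ u v, motive u → motive v → motive (u + v))
    (mul : ∀ u v, motive u → motive v → motive (u * v)) : motive u := by
  have hu : u ∈ Algebra.adjoin k (Set.range (UniversalEnvelopingAlgebra.ι k : G → 𝓤 G)) := by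
    rw [adjoin_range_ι]; trivial
  induction hu using Algebra.adjoin_induction with
  | mem u hu => obtain ⟨g, rfl⟩ := hu; exact ι g
  | algebraMap c => exact algebraMap c
  | add u v _ _ hu hv => exact add u v hu hv
  | mul u v _ _ hu hv => exact mul u v hu hv

/-- The derivation of the enveloping algebra induced by a derivation of the Lie algebra. -/
def envelopingDerivationHom (D : LieDerivation k G G) : 𝓤 G →ₐ[k] TrivSqZeroExt (𝓤 G) (𝓤 G) :=
  UniversalEnvelopingAlgebra.lift k
    { toFun := fun g => TrivSqZeroExt.inl (UniversalEnvelopingAlgebra.ι k g) +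
        TrivSqZeroExt.inr (UniversalEnvelopingAlgebra.ι k (D g))
      map_add' := fun g h => by ext <;> simp
      map_smul' := fun c g => by ext <;> simp
      map_lie' := fun {g h} => by
        ext
        · simp [LieRing.of_associative_ring_bracket]
        · rw [LieDerivation.apply_lie_eq_sub, map_sub, LieHom.map_lie, LieHom.map_lie]
          simp [LieRing.of_associative_ring_bracket, -UniversalEnvelopingAlgebra.ι_apply]
          abel }

theorem fst_envelopingDerivationHom (D : LieDerivation k G G) (u : 𝓤 G) :
    (envelopingDerivationHom k D u).fst = u := by
  have : (TrivSqZeroExt.fstHom k (𝓤 G) (𝓤 G)).comp (envelopingDerivationHom k D) =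
      AlgHom.id k _ := by
    apply UniversalEnvelopingAlgebra.hom_ext
    ext g
    simp [envelopingDerivationHom]
  exact AlgHom.congr_fun this u

/-- The derivation of the enveloping algebra induced by a derivation of the Lie algebra. -/
def envelopingDerivation (D : LieDerivation k G G) : 𝓤 G →ₗ[k] 𝓤 G :=
  TrivSqZeroExt.sndHom (𝓤 G) (𝓤 G) ∘ₗ (envelopingDerivationHom k D).toLinearMap

variable {k}

@[simp]
theorem envelopingDerivation_ι (D : LieDerivation k G G) (g : G) :
    envelopingDerivation k D (UniversalEnvelopingAlgebra.ι k g) =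
      UniversalEnvelopingAlgebra.ι k (D g) := by
  simp [envelopingDerivation, envelopingDerivationHom]

theorem envelopingDerivation_mul (D : LieDerivation k G G) (u v : 𝓤 G) :
    envelopingDerivation k D (u * v) =
      u * envelopingDerivation k D v + envelopingDerivation k D u * v := by
  simp [envelopingDerivation, fst_envelopingDerivationHom]

theorem envelopingDerivation_algebraMap (D : LieDerivation k G G) (c : k) :
    envelopingDerivation k D (algebraMap k _ c) = 0 := by
  simp [envelopingDerivation, TrivSqZeroExt.algebraMap_eq_inl']

end Enveloping

/-! ### The module underlying a differential operator extension. -/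

section OreModule

variable {k : Type*} [Field k] {T : Type*} [Ring T] [Algebra k T] (δ : T →ₗ[k] T)

/-- Left multiplication on the coefficients of `T[X]`. -/
def coeffMul : T →ₗ[k] Module.End k (ℕ →₀ T) where
  toFun t := Finsupp.mapRange.linearMap (LinearMap.mulLeft k t)
  map_add' s t := Finsupp.lhom_ext fun n r => by simp [add_mul, -Finsupp.single_mul]
  map_smul' c t := Finsupp.lhom_ext fun n s => by simp [-Finsupp.single_mul]

@[simp]
theorem coeffMul_single (t : T) (n : ℕ) (s : T) :
    coeffMul (k := k) t (Finsupp.single n s) = Finsupp.single n (t * s) := by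
  simp [coeffMul]

/-- Left multiplication by the variable in the differential operator extension `T[X; δ]`. -/
def oreMul : Module.End k (ℕ →₀ T) :=
  Finsupp.mapRange.linearMap δ + Finsupp.lmapDomain T k Nat.succ

@[simp]
theorem oreMul_single (n : ℕ) (s : T) :
    oreMul δ (Finsupp.single n s) = Finsupp.single n (δ s) + Finsupp.single (n + 1) s := by
  simp [oreMul, Finsupp.mapDomain_single]

theorem oreMul_apply_succ (f : ℕ →₀ T) (n : ℕ) : oreMul δ f (n + 1) = δ (f (n + 1)) + f n := by
  have : Finsupp.mapDomain Nat.succ f (n + 1) = f n :=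
    Finsupp.mapDomain_apply Nat.succ_injective f n
  simp [oreMul, this]

/-- In the kernel each coefficient is minus `δ` of the next one, so finite support forces all of
them to vanish, from the top down. -/
theorem oreMul_injective : Function.Injective (oreMul δ) := by
  rw [injective_iff_map_eq_zero]
  intro f hf
  have h1 : ∀ n, f n = -δ (f (n + 1)) := fun n => by
    have := oreMul_apply_succ δ f n
    rw [hf, Finsupp.zero_apply] at this
    exact (neg_eq_of_add_eq_zero_right this.symm).symm
  have h2 : ∀ N n, (∀ m, n + N ≤ m → f m = 0) → f n = 0 := by
    intro N
    induction N with
    | zero => exact fun n h => h n le_rfl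
    | succ N ih =>
      intro n h
      rw [h1, ih (n + 1) fun m hm => h m (by omega), map_zero, neg_zero]
  ext n
  refine h2 (f.support.sup id + 1) n fun m hm => ?_
  by_contra hm0
  have := Finset.le_sup (f := id) (Finsupp.mem_support_iff.2 hm0)
  simp only [id] at this
  omega

theorem coeffMul_mul (s t : T) : coeffMul (k := k) (s * t) = coeffMul s * coeffMul t := by
  refine Finsupp.lhom_ext fun n r => ?_
  simp [mul_assoc, -Finsupp.single_mul]

/-- The commutation rule `X t = t X + δ t` of `T[X; δ]` is the Leibniz rule on coefficients. -/
theorem oreMul_mul_coeffMul (hδ : ∀ s t, δ (s * t) = s * δ t + δ s * t) (t : T) :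
    oreMul δ * coeffMul t = coeffMul t * oreMul δ + coeffMul (δ t) := by
  refine Finsupp.lhom_ext fun n s => ?_
  simp [hδ, Finsupp.single_add, -Finsupp.single_mul]
  abel

end OreModule

/-! ### Regularity of left multiplication in the enveloping algebra. -/

section Regular

attribute [local instance 100] LieRing.ofAssociativeRing

variable {k : Type*} [Field k] {G : Type*} [LieRing G] [LieAlgebra k G]
  (χ : G →ₗ⁅k⁆ AbelianLie k) {g : G} (hg : χ g = AbelianLie.of k k 1)

local notation "𝓤" => UniversalEnvelopingAlgebra k

/-- The action of an element on an ideal. -/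
def idealDerivation (I : LieIdeal k G) (g : G) : LieDerivation k I I where
  toFun i := ⟨⁅g, (i : G)⁆, I.lie_mem i.2⟩
  map_add' i j := Subtype.ext (lie_add g (i : G) j)
  map_smul' c i := Subtype.ext (lie_smul c g (i : G))
  leibniz' i j := Subtype.ext <| by
    change ⁅g, ⁅(i : G), (j : G)⁆⁆ = ⁅(i : G), ⁅g, (j : G)⁆⁆ - ⁅(j : G), ⁅g, (i : G)⁆⁆
    rw [leibniz_lie, ← lie_skew (⁅g, (i : G)⁆) (j : G)]
    abel

/-- The functional underlying a homomorphism to the one-dimensional Lie algebra. -/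
def functional : G →ₗ[k] k := (AbelianLie.of k k).symm ∘ₗ (χ : G →ₗ[k] AbelianLie k)

theorem functional_lie (s t : G) : functional χ ⁅s, t⁆ = 0 := by
  change (AbelianLie.of k k).symm (χ ⁅s, t⁆) = 0
  rw [LieHom.map_lie]; rfl

include hg in
theorem functional_eq_one : functional χ g = 1 := by
  change (AbelianLie.of k k).symm (χ g) = 1
  rw [hg, LinearEquiv.symm_apply_apply]

theorem mem_ker_iff_functional {s : G} : s ∈ χ.ker ↔ functional χ s = 0 := by
  rw [LieHom.mem_ker]; rfl

/-- The projection of `G` onto the kernel of `χ` along `g`. -/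
def kerProj : G →ₗ[k] χ.ker :=
  LinearMap.codRestrict χ.ker.toSubmodule (LinearMap.id - (functional χ).smulRight g) fun s => by
    change _ ∈ χ.ker
    rw [mem_ker_iff_functional]
    simp [functional_eq_one χ hg]

theorem coe_kerProj (s : G) : (kerProj χ hg s : G) = s - functional χ s • g := rfl

theorem kerProj_lie (s t : G) : kerProj χ hg ⁅s, t⁆ = ⁅kerProj χ hg s, kerProj χ hg t⁆ +
    functional χ s • idealDerivation χ.ker g (kerProj χ hg t) -
    functional χ t • idealDerivation χ.ker g (kerProj χ hg s) := by
  apply Subtype.ext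
  change ⁅s, t⁆ - functional χ ⁅s, t⁆ • g =
    ⁅s - functional χ s • g, t - functional χ t • g⁆ +
    functional χ s • ⁅g, t - functional χ t • g⁆ - functional χ t • ⁅g, s - functional χ s • g⁆
  rw [functional_lie]
  simp only [zero_smul, sub_zero, sub_lie, lie_sub, lie_smul, smul_lie, lie_self, smul_zero]
  rw [← lie_skew g s]
  module

/-- The derivation of the enveloping algebra of the kernel of `χ` given by `g`. -/
def kerDerivation (g : G) : 𝓤 χ.ker →ₗ[k] 𝓤 χ.ker :=
  envelopingDerivation k (idealDerivation χ.ker g)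

theorem kerDerivation_mul (g : G) (s t : 𝓤 χ.ker) : kerDerivation χ g (s * t) =
    s * kerDerivation χ g t + kerDerivation χ g s * t := envelopingDerivation_mul _ s t

theorem kerDerivation_ι (g : G) (i : χ.ker) :
    kerDerivation χ g (UniversalEnvelopingAlgebra.ι k i) =
      UniversalEnvelopingAlgebra.ι k (idealDerivation χ.ker g i) := envelopingDerivation_ι _ i

/-- The linear map underlying `oreRep`. -/
def oreRepLinear : G →ₗ[k] Module.End k (ℕ →₀ 𝓤 χ.ker) :=
  coeffMul ∘ₗ (UniversalEnvelopingAlgebra.ι k : χ.ker →ₗ⁅k⁆ 𝓤 χ.ker).toLinearMap ∘ₗ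
    kerProj χ hg + (functional χ).smulRight (oreMul (kerDerivation χ g))

theorem oreRepLinear_apply (s : G) : oreRepLinear χ hg s =
    coeffMul (UniversalEnvelopingAlgebra.ι k (kerProj χ hg s)) +
      functional χ s • oreMul (kerDerivation χ g) := rfl

theorem oreMul_mul_coeffMul_ι (i : χ.ker) :
    oreMul (kerDerivation χ g) * coeffMul (UniversalEnvelopingAlgebra.ι k i) =
      coeffMul (UniversalEnvelopingAlgebra.ι k i) * oreMul (kerDerivation χ g) +
        coeffMul (UniversalEnvelopingAlgebra.ι k (idealDerivation χ.ker g i)) := by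
  rw [oreMul_mul_coeffMul _ (kerDerivation_mul χ g), kerDerivation_ι]

theorem oreRepLinear_lie (s t : G) : oreRepLinear χ hg ⁅s, t⁆ =
    oreRepLinear χ hg s * oreRepLinear χ hg t - oreRepLinear χ hg t * oreRepLinear χ hg s := by
  rw [oreRepLinear_apply, oreRepLinear_apply, oreRepLinear_apply, functional_lie, kerProj_lie]
  generalize kerProj χ hg s = i
  generalize kerProj χ hg t = j
  generalize functional χ s = c
  generalize functional χ t = d
  rw [map_sub, map_add, LieHom.map_lie, map_smul, map_smul, LieRing.of_associative_ring_bracket,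
    map_sub, map_add, map_sub, map_smul, map_smul, coeffMul_mul, coeffMul_mul]
  simp only [add_mul, mul_add, smul_mul_assoc, mul_smul_comm, oreMul_mul_coeffMul_ι]
  module

/-- The representation of `G` on `T[X; δ]`, with `T` the enveloping algebra of the kernel of `χ`,
in which `g` acts as multiplication by the variable. -/
def oreRep : G →ₗ⁅k⁆ Module.End k (ℕ →₀ 𝓤 χ.ker) where
  toLinearMap := oreRepLinear χ hg
  map_lie' {s t} := oreRepLinear_lie χ hg s t

theorem oreRep_apply (s : G) : oreRep χ hg s =
    coeffMul (UniversalEnvelopingAlgebra.ι k (kerProj χ hg s)) +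
      functional χ s • oreMul (kerDerivation χ g) := rfl

theorem oreRep_self : oreRep χ hg g = oreMul (kerDerivation χ g) := by
  have : kerProj χ hg g = 0 := Subtype.ext (by
    rw [coe_kerProj, functional_eq_one χ hg, one_smul, sub_self]; rfl)
  rw [oreRep_apply, this, map_zero, map_zero, functional_eq_one χ hg, one_smul, zero_add]

/-- The map of enveloping algebras induced by the inclusion of the kernel of `χ`. -/
def kerIncl : 𝓤 χ.ker →ₐ[k] 𝓤 G :=
  UniversalEnvelopingAlgebra.lift k ((UniversalEnvelopingAlgebra.ι k).comp χ.ker.incl)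

theorem kerIncl_ι (i : χ.ker) :
    kerIncl χ (UniversalEnvelopingAlgebra.ι k i) = UniversalEnvelopingAlgebra.ι k (i : G) := by
  rw [kerIncl, UniversalEnvelopingAlgebra.lift_ι_apply]; rfl

/-- Both sides are derivations along `kerIncl χ`, and they agree on the kernel of `χ`. -/
theorem kerIncl_kerDerivation (g : G) (t : 𝓤 χ.ker) : kerIncl χ (kerDerivation χ g t) =
    UniversalEnvelopingAlgebra.ι k g * kerIncl χ t -
      kerIncl χ t * UniversalEnvelopingAlgebra.ι k g := by
  induction t using enveloping_induction with
  | ι i =>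
    rw [kerDerivation, envelopingDerivation_ι, kerIncl_ι, kerIncl_ι,
      ← LieRing.of_associative_ring_bracket, ← LieHom.map_lie]
    rfl
  | algebraMap c =>
    rw [kerDerivation, envelopingDerivation_algebraMap, map_zero, AlgHom.commutes,
      Algebra.commutes, sub_self]
  | add s t hs ht => simp only [map_add, hs, ht]; noncomm_ring
  | mul s t hs ht =>
    rw [kerDerivation, envelopingDerivation_mul, ← kerDerivation]
    simp only [map_add, map_mul, hs, ht]; noncomm_ring

/-- The identification of `T[X; δ]` with the enveloping algebra of `G`. -/
def oreToEnveloping (g : G) : (ℕ →₀ 𝓤 χ.ker) →ₗ[k] 𝓤 G :=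
  Finsupp.lsum k fun n =>
    LinearMap.mulRight k (UniversalEnvelopingAlgebra.ι k g ^ n) ∘ₗ (kerIncl χ).toLinearMap

theorem oreToEnveloping_single (n : ℕ) (t : 𝓤 χ.ker) :
    oreToEnveloping χ g (Finsupp.single n t) =
      kerIncl χ t * UniversalEnvelopingAlgebra.ι k g ^ n := by
  simp [oreToEnveloping]

theorem oreToEnveloping_oreRep (s : G) (v : ℕ →₀ 𝓤 χ.ker) :
    oreToEnveloping χ g (oreRep χ hg s v) =
      UniversalEnvelopingAlgebra.ι k s * oreToEnveloping χ g v := by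
  have hs : UniversalEnvelopingAlgebra.ι k s =
      kerIncl χ (UniversalEnvelopingAlgebra.ι k (kerProj χ hg s)) +
        functional χ s • UniversalEnvelopingAlgebra.ι k g := by
    rw [kerIncl_ι, coe_kerProj, map_sub, map_smul, sub_add_cancel]
  induction v using Finsupp.induction_linear with
  | zero => simp
  | add v w hv hw => rw [map_add, map_add, map_add, hv, hw, mul_add]
  | single n t =>
    rw [oreRep_apply, LinearMap.add_apply, LinearMap.smul_apply, coeffMul_single, oreMul_single,
      map_add, map_smul, map_add, oreToEnveloping_single, oreToEnveloping_single,
      oreToEnveloping_single, oreToEnveloping_single, hs, map_mul, kerIncl_kerDerivation, pow_succ']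
    simp only [add_mul, sub_mul, smul_mul_assoc, mul_assoc, sub_add_cancel]

/-- Taking `v = 1` shows that `u` is recovered from its action on `1`, so the action on `T[X; δ]` is
faithful without a basis theorem. -/
theorem oreToEnveloping_lift (u : 𝓤 G) (v : ℕ →₀ 𝓤 χ.ker) :
    oreToEnveloping χ g (UniversalEnvelopingAlgebra.lift k (oreRep χ hg) u v) =
      u * oreToEnveloping χ g v := by
  induction u using enveloping_induction generalizing v with
  | ι s => rw [UniversalEnvelopingAlgebra.lift_ι_apply, oreToEnveloping_oreRep]
  | algebraMap c =>
    rw [AlgHom.commutes, Module.algebraMap_end_apply, map_smul, Algebra.smul_def]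
  | add u u' hu hu' => rw [map_add, LinearMap.add_apply, map_add, hu, hu', add_mul]
  | mul u u' hu hu' => rw [map_mul, Module.End.mul_apply, hu, hu', mul_assoc]

include hg in
/-- Left multiplication by an element outside the derived algebra is injective on the enveloping
algebra. -/
theorem eq_zero_of_ι_mul_eq_zero {u : 𝓤 G} (h : UniversalEnvelopingAlgebra.ι k g * u = 0) :
    u = 0 := by
  have h1 := congrArg (fun u => UniversalEnvelopingAlgebra.lift k (oreRep χ hg) u
    (Finsupp.single 0 1)) h
  simp only [map_mul, Module.End.mul_apply, UniversalEnvelopingAlgebra.lift_ι_apply, oreRep_self,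
    map_zero, LinearMap.zero_apply] at h1
  -- As `g` acts by the variable, cancelling it shows that `u` kills `1`, whose image in the
  -- enveloping algebra is `u` itself.
  have h2 := (injective_iff_map_eq_zero _).1 (oreMul_injective _) _ h1
  have h3 := oreToEnveloping_lift χ hg u (Finsupp.single 0 1)
  rw [h2, map_zero, oreToEnveloping_single, map_one, pow_zero, mul_one, mul_one] at h3
  exact h3.symm

include hg in
-- The character `χ` induces a surjection onto a polynomial ring sending `g` to the variable.
theorem not_finiteDimensional_enveloping : ¬ FiniteDimensional k (𝓤 G) := by
  intro hfin
  let f : G →ₗ⁅k⁆ Polynomial k :=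
    { toLinearMap := (functional χ).smulRight Polynomial.X
      map_lie' := fun {s t} => by
        change functional χ ⁅s, t⁆ • Polynomial.X = _
        rw [functional_lie, zero_smul, LieRing.of_associative_ring_bracket, mul_comm, sub_self] }
  have hf : f g = Polynomial.X := by
    change functional χ g • Polynomial.X = _
    rw [functional_eq_one χ hg, one_smul]
  have hsurj : Function.Surjective (UniversalEnvelopingAlgebra.lift k f) := by
    rw [← AlgHom.range_eq_top, eq_top_iff, ← Polynomial.adjoin_X, Algebra.adjoin_le_iff,
      Set.singleton_subset_iff]
    exact ⟨UniversalEnvelopingAlgebra.ι k g, by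
      change UniversalEnvelopingAlgebra.lift k f _ = _
      rw [UniversalEnvelopingAlgebra.lift_ι_apply, hf]⟩
  exact Polynomial.not_finite (Module.Finite.of_surjective
    (UniversalEnvelopingAlgebra.lift k f).toLinearMap hsurj)

end Regular

/-! ### Infinitely many independent cohomology classes. -/

section Ends

variable {k : Type*} [Field k] {G : Type*} [LieRing G] [LieAlgebra k G] (e : Pres k ≃ₗ⁅k⁆ G)

theorem lieSpan_range_equiv :
    LieSubalgebra.lieSpan k G (Set.range fun i => e (Pres.of k i)) = ⊤ := by
  refine eq_top_iff.2 fun y _ => ?_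
  have hy : e.symm y ∈ LieSubalgebra.lieSpan k (Pres k)
      (Set.range (Presented.of k (relators k))) := by
    rw [Presented.lieSpan_range_of]; trivial
  have : LieSubalgebra.lieSpan k (Pres k) (Set.range (Presented.of k (relators k))) ≤
      (LieSubalgebra.lieSpan k G (Set.range fun i => e (Pres.of k i))).comap
        (e : Pres k →ₗ⁅k⁆ G) := by
    rw [LieSubalgebra.lieSpan_le]
    rintro _ ⟨x, rfl⟩
    exact LieSubalgebra.subset_lieSpan ⟨x, rfl⟩
  have h := this hy
  rw [LieSubalgebra.mem_comap] at h
  change e (e.symm y) ∈ _ at h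
  rwa [LieEquiv.apply_symm_apply] at h

variable {V : Type*} [AddCommGroup V] [Module k V] [LieRingModule G V] [LieModule k G V]

theorem SquareZero.mk_lie_mk (g h : G) (v w : V) :
    ⁅SquareZero.mk g v, SquareZero.mk h w⁆ = SquareZero.mk ⁅g, h⁆ (⁅g, w⁆ - ⁅h, v⁆) := rfl

theorem equiv_a_lie_b : ⁅e (Pres.of k .a), e (Pres.of k .b)⁆ = 0 := by
  rw [← LieEquiv.map_lie, Pres.a_lie_b, map_zero]

theorem equiv_z_lie_b : ⁅e (Pres.of k .z), e (Pres.of k .b)⁆ =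
    ⁅e (Pres.of k .t), e (Pres.of k .a)⁆ := by
  rw [← LieEquiv.map_lie, ← LieEquiv.map_lie, Pres.z_lie_b]

/-- The splitting of the split extension by `V` corresponding to the derivation that sends `a` and
`b` to `0`, `z` to `[a, v]` and `t` to `[b, v]`. -/
def splitting (v : V) : Pres k →ₗ⁅k⁆ SquareZero G V :=
  Pres.lift (fun
    | .a => SquareZero.mk (e (Pres.of k .a)) 0
    | .b => SquareZero.mk (e (Pres.of k .b)) 0
    | .z => SquareZero.mk (e (Pres.of k .z)) ⁅e (Pres.of k .a), v⁆
    | .t => SquareZero.mk (e (Pres.of k .t)) ⁅e (Pres.of k .b), v⁆)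
    (by
      change ⁅SquareZero.mk _ _, SquareZero.mk _ _⁆ = ⁅SquareZero.mk _ _, SquareZero.mk _ _⁆
      rw [SquareZero.mk_lie_mk, SquareZero.mk_lie_mk, equiv_z_lie_b, lie_zero, lie_zero,
        leibniz_lie (e (Pres.of k .a)), equiv_a_lie_b, zero_lie, zero_add])
    (by
      change ⁅SquareZero.mk _ _, SquareZero.mk _ _⁆ = 0
      rw [SquareZero.mk_lie_mk, equiv_a_lie_b, lie_zero, lie_zero, sub_zero]
      rfl)

theorem fst_comp_splitting (v : V) :
    (SquareZero.fst k G V).comp ((splitting e v).comp (e.symm : G →ₗ⁅k⁆ Pres k)) = 1 := by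
  have h : (SquareZero.fst k G V).comp (splitting e v) = (e : Pres k →ₗ⁅k⁆ G) :=
    Presented.hom_ext fun i => by
      rw [LieHom.comp_apply, splitting, Pres.lift_of]
      cases i <;> rfl
  ext y
  refine (LieHom.congr_fun h (e.symm y)).trans ?_
  exact e.apply_symm_apply y

/-- The derivation that sends `a` and `b` to `0`, `z` to `[a, v]` and `t` to `[b, v]`. -/
def cocycle (v : V) : LieDerivation k G V :=
  SquareZero.derivation ((splitting e v).comp (e.symm : G →ₗ⁅k⁆ Pres k)) (fst_comp_splitting e v)

theorem cocycle_apply (v : V) (i : Gen) :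
    cocycle e v (e (Pres.of k i)) = (splitting e v (Pres.of k i)).2 := by
  rw [cocycle, SquareZero.derivation_apply]
  change (splitting e v (e.symm (e (Pres.of k i)))).2 = _
  rw [LieEquiv.symm_apply_apply]

theorem cocycle_a (v : V) : cocycle e v (e (Pres.of k .a)) = 0 := by
  rw [cocycle_apply, splitting, Pres.lift_of]; rfl

theorem cocycle_b (v : V) : cocycle e v (e (Pres.of k .b)) = 0 := by
  rw [cocycle_apply, splitting, Pres.lift_of]; rfl

theorem cocycle_z (v : V) : cocycle e v (e (Pres.of k .z)) = ⁅e (Pres.of k .a), v⁆ := by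
  rw [cocycle_apply, splitting, Pres.lift_of]; rfl

theorem cocycle_t (v : V) : cocycle e v (e (Pres.of k .t)) = ⁅e (Pres.of k .b), v⁆ := by
  rw [cocycle_apply, splitting, Pres.lift_of]; rfl

theorem derivation_ext {D₁ D₂ : LieDerivation k G V}
    (h : ∀ i, D₁ (e (Pres.of k i)) = D₂ (e (Pres.of k i))) : D₁ = D₂ :=
  LieDerivation.ext_of_lieSpan_eq_top _ (lieSpan_range_equiv e) (by rintro _ ⟨i, rfl⟩; exact h i)

theorem cocycle_add (v w : V) : cocycle e (v + w) = cocycle e v + cocycle e w :=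
  derivation_ext e fun i => by
    rw [LieDerivation.add_apply]
    cases i <;> simp only [cocycle_a, cocycle_b, cocycle_z, cocycle_t, lie_add, add_zero]

theorem cocycle_smul (c : k) (v : V) : cocycle e (c • v) = c • cocycle e v :=
  derivation_ext e fun i => by
    rw [LieDerivation.smul_apply]
    cases i <;> simp only [cocycle_a, cocycle_b, cocycle_z, cocycle_t, lie_smul, smul_zero]

/-- The cocycles `cocycle e v` depend linearly on `v`. -/
def cocycleMap : V →ₗ[k] LinearMap.ker (LieModule.Cohomology.d₁₂ k G V) where
  toFun v := ⟨(cocycle e v).toLinearMap, by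
    rw [LinearMap.mem_ker]
    apply Subtype.ext
    ext s t
    change ⁅s, cocycle e v t⁆ - ⁅t, cocycle e v s⁆ - cocycle e v ⁅s, t⁆ = 0
    rw [LieDerivation.apply_lie_eq_sub, sub_self]⟩
  map_add' v w := Subtype.ext (by rw [cocycle_add]; rfl)
  map_smul' c v := Subtype.ext (by rw [cocycle_smul]; rfl)

/-- The map `v ↦ cocycle e v` stays injective in cohomology. If `cocycle e v` is inner, given by
`w`, its value at `a` yields `[a, w] = 0`, so `w = 0`; its value at `z` then yields `[a, v] = 0`, so
`v = 0`. -/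
theorem not_finiteDimensional_H1 (hreg : ∀ v : V, ⁅e (Pres.of k .a), v⁆ = 0 → v = 0)
    (hV : ¬ FiniteDimensional k V) : ¬ FiniteDimensional k (H1 k G V) := by
  intro hfin
  let f : V →ₗ[k] H1 k G V := Submodule.mkQ _ ∘ₗ cocycleMap e
  refine hV (Module.Finite.of_injective f ?_)
  rw [injective_iff_map_eq_zero]
  intro v hv
  obtain ⟨w, hw⟩ := (Submodule.Quotient.mk_eq_zero _).1 hv
  have hw' : ∀ s, ⁅s, w⁆ = cocycle e v s := fun s => LinearMap.congr_fun hw s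
  have hw0 : w = 0 := hreg w ((hw' _).trans (cocycle_a e v))
  refine hreg v ?_
  rw [← cocycle_z, ← hw', hw0, lie_zero]

include e in
theorem hasInfinitelyManyEnds_of_equiv : HasInfinitelyManyEnds k G := by
  let f : Pres k →ₗ⁅k⁆ AbelianLie k := Pres.lift
    (fun
      | .a => AbelianLie.of k k 1
      | .b => 0
      | .z => 0
      | .t => 0) rfl rfl
  let χ : G →ₗ⁅k⁆ AbelianLie k := f.comp (e.symm : G →ₗ⁅k⁆ Pres k)
  have hχ : χ (e (Pres.of k .a)) = AbelianLie.of k k 1 := by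
    change f (e.symm (e (Pres.of k .a))) = _
    rw [LieEquiv.symm_apply_apply, Pres.lift_of]
  exact not_finiteDimensional_H1 e
    (fun v hv => eq_zero_of_ι_mul_eq_zero χ hχ (u := (RegularModule.equiv k G).symm v) hv)
    (not_finiteDimensional_enveloping χ hχ)

end Ends

end LieKurosh

end

/-! ### The main theorem. -/

open LieKurosh in
theorem mainTheorem11 (k : Type*) [Field k] :
    -- `L` is positively graded, and `S` is a graded subalgebra containing `M`
    IsPositiveGrading (grading k) ∧
    IsGradedSubalgebra (grading k) (S k) ∧
    (FreeProduct.inl k (M k) (N k)).range ≤ S k ∧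
    -- `S = ⟨a, b, z, t | [z, b] - [t, a], [a, b]⟩` on its generators `a, b, z, t`
    (∃ e : Presented k (relators k) ≃ₗ⁅k⁆ S k,
      ∀ g : Gen, (e (Presented.of k (relators k) g) : L k) = genInL k g) ∧
    -- `S` is not `M * Q`
    (∀ (Q : Type*) [LieRing Q] [LieAlgebra k Q], IsEmpty (S k ≃ₗ⁅k⁆ FreeProduct k (M k) Q)) ∧
    -- `S` is not the free product of two nonzero graded subalgebras
    (∀ C D : LieSubalgebra k (L k), C ≤ S k → D ≤ S k → C ≠ ⊥ → D ≠ ⊥ →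
      IsGradedSubalgebra (grading k) C → IsGradedSubalgebra (grading k) D →
      IsEmpty (S k ≃ₗ⁅k⁆ FreeProduct k C D)) ∧
    -- `S` has infinitely many ends
    HasInfinitelyManyEnds k (S k) := by
  refine ⟨isPositiveGrading, isGradedSubalgebra_S, range_inl_le_S k,
    ⟨Pres.equivS k, Pres.equivS_of k⟩, ?_, ?_, hasInfinitelyManyEnds_of_equiv (Pres.equivS k)⟩
  · intro Q _ _
    refine ⟨fun f => ?_⟩
    obtain ⟨χ, hχ⟩ := exists_hom_M_ne_zero (k := k)
    obtain ⟨η, hη⟩ := exists_hom_ne_zero_of_equiv_freeProduct_M ((Pres.equivS k).trans f)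
    exact (isEmpty_equiv_freeProduct hχ hη).false ((Pres.equivS k).trans f)
  · intro C D _ _ hC hD hCgr hDgr
    refine ⟨fun f => ?_⟩
    obtain ⟨χ, hχ⟩ := exists_hom_ne_zero_of_isGradedSubalgebra hC hCgr
    obtain ⟨η, hη⟩ := exists_hom_ne_zero_of_isGradedSubalgebra hD hDgr
    exact (isEmpty_equiv_freeProduct hχ hη).false ((Pres.equivS k).trans f)
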